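/- Let $J\ge 1$, let $\mathbf g\in\mathbb C^J$ be a fixed nonzero channel, $\sigma>0$, and let $\mathbf r(i)=b(i)\mathbf g+\mathbf n(i)$, $i=1,2,\dots$, where the symbols $b(i)$ are $\pm1$ with probability $1/2$ each, the noise vectors $\mathbf n(i)$ are circularly symmetric complex Gaussian $\mathcal{CN}(\mathbf 0,\sigma^2\mathbf I)$, and all of them are independent. For $\mathbf z\in\mathbb C^J$ let $\bar{\mathbf z}=[\Re\{\mathbf z\}^T,\Im\{\mathbf z\}^T]^T\in\mathbb R^{2J}$, and put $\mathbf h=\mathbf g/\|\mathbf g\|$, $\bar{\mathbf R}=\mathbb E[\bar{\mathbf r}(i)\bar{\mathbf r}(i)^T]$, $\hat{\bar{\mathbf R}}=\frac1N\sum_{i=1}^N\bar{\mathbf r}(i)\bar{\mathbf r}(i)^T$, $\delta\bar{\mathbf R}=\hat{\bar{\mathbf R}}-\bar{\mathbf R}$. Let $\hat{\bar{\mathbf u}}$ be a (measurably chosen) unit-norm eigenvector of $\hat{\bar{\mathbf R}}$ for its largest eigenvalue, $b_o=\operatorname{sgn}(\hat{\bar{\mathbf u}}^T\bar{\mathbf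 h})$ the sign that minimizes $\|b\,\hat{\bar{\mathbf u}}-\bar{\mathbf h}\|$ over $b\in\{\pm1\}$ (with $\operatorname{sgn}(0)=1$), and decompose the error as $\delta\bar{\mathbf h}_o=b_o\hat{\bar{\mathbf u}}-\bar{\mathbf h}=\bar{\mathbf q}_o+\mu_o\bar{\mathbf h}$ with $\mu_o\in\mathbb R$ and $\bar{\mathbf q}_o\perp\bar{\mathbf h}$. Set $$F=\frac{1}{N\|\mathbf g\|^4}\left(\frac{\sigma^2}{2}\|\mathbf g\|^2+\frac{\sigma^4}{4}\right)(2J-1).$$ (i) For every $N\ge1$, exactly, $$\mathbb E\left[\delta\bar{\mathbf R}\,\bar{\mathbf h}\bar{\mathbf h}^T\delta\bar{\mathbf R}\right]=\frac1N\left[\left(\frac32\sigma^2\|\mathbf g\|^2+\frac{\sigma^4}4\right)\bar{\mathbf h}\bar{\mathbf h}^T+\left(\frac{\sigma^2}2\|\mathbf g\|^2+\frac{\sigma^4}4\right)\mathbf I\right].$$ (ii) As $N\to\infty$ with $\mathbf g$, $\sigma$ fixed: $|\mu_o|^2=o(\|\bar{\mathbf q}_o\|^2)$ almost surely, $\mathbb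 E|\mu_o|^2=o(\mathbb E\|\bar{\mathbf q}_o\|^2)$, and $$\mathbb E\|\delta\bar{\mathbf h}_o\|^2\sim\mathbb E\|\bar{\mathbf q}_o\|^2\sim F.$$ (iii) The same approximations hold whenever $F$ is small, uniformly in the channel, the noise level and the sample size: for all $J\ge1$ and $\varepsilon>0$ there is $\eta>0$, depending only on $J$ and $\varepsilon$, such that for all $\mathbf g\ne0$, $\sigma>0$ and $N\ge1$ with $F\le\eta$ we have $P\{|\mu_o|^2>\varepsilon\|\bar{\mathbf q}_o\|^2\}\le\varepsilon$, $\mathbb E|\mu_o|^2\le\varepsilon\,\mathbb E\|\bar{\mathbf q}_o\|^2$, $\big|\mathbb E\|\delta\bar{\mathbf h}_o\|^2-\mathbb E\|\bar{\mathbf q}_o\|^2\big|\le\varepsilon\,\mathbb E\|\bar{\mathbf q}_o\|^2$ and $\big|\mathbb E\|\bar{\mathbf q}_o\|^2-F\big|\le\varepsilon F$. -/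

import Mathlib

open MeasureTheory ProbabilityTheory Filter Asymptotics

noncomputable section

namespace SIMO

/-- The real representation `[Re zᵀ, Im zᵀ]ᵀ ∈ ℝ^{2J}` of a vector `z ∈ ℂ^J`. -/
def realRep {J : ℕ} (z : EuclideanSpace ℂ (Fin J)) : EuclideanSpace ℝ (Fin J ⊕ Fin J) :=
  WithLp.toLp 2 (Sum.elim (fun k => (z k).re) (fun k => (z k).im))

/-- The unit-norm channel `h = g / ‖g‖`. -/
def normalizedChannel {J : ℕ} (g : EuclideanSpace ℂ (Fin J)) : EuclideanSpace ℂ (Fin J) :=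
  ((‖g‖ : ℂ)⁻¹) • g

/-- The real representation of the unit-norm channel. -/
def hbar {J : ℕ} (g : EuclideanSpace ℂ (Fin J)) : EuclideanSpace ℝ (Fin J ⊕ Fin J) :=
  realRep (normalizedChannel g)

/-- BPSK symbols in white circular complex Gaussian noise: the symbols `b i` are `±1` with equal
probability, the noise vectors `n i` are `CN(0, σ² I)` (real and imaginary parts of the entries are
independent, centred Gaussian with variance `σ² / 2`), and all of them are independent. -/
structure IsBPSKModel {J : ℕ} {Ω : Type*} [MeasurableSpace Ω] (P : Measure Ω) (σ : ℝ)
    (b : ℕ → Ω → ℝ) (n : ℕ → Ω → EuclideanSpace ℂ (Fin J)) : Prop where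
  measurable_symbol : ∀ i, Measurable (b i)
  measurable_noise : ∀ i, Measurable (n i)
  symbol_one : ∀ i, P {ω | b i ω = 1} = 1 / 2
  symbol_neg_one : ∀ i, P {ω | b i ω = -1} = 1 / 2
  noise_law : ∀ i, P.map (fun ω => realRep (n i ω)) =
    multivariateGaussian 0 ((σ ^ 2 / 2) • (1 : Matrix (Fin J ⊕ Fin J) (Fin J ⊕ Fin J) ℝ))
  indep_symbol_noise : ∀ i, IndepFun (b i) (n i) P
  indep_samples : iIndepFun (fun i ω => (b i ω, n i ω)) P

section Estimator

variable {J : ℕ} {Ω : Type*} [MeasurableSpace Ω]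

/-- The received vector `r(i) = b(i) g + n(i)`. -/
def received (g : EuclideanSpace ℂ (Fin J)) (b : ℕ → Ω → ℝ)
    (n : ℕ → Ω → EuclideanSpace ℂ (Fin J)) (i : ℕ) (ω : Ω) : EuclideanSpace ℂ (Fin J) :=
  (b i ω : ℂ) • g + n i ω

/-- The real representation of the received vector. -/
def rbar (g : EuclideanSpace ℂ (Fin J)) (b : ℕ → Ω → ℝ)
    (n : ℕ → Ω → EuclideanSpace ℂ (Fin J)) (i : ℕ) (ω : Ω) : EuclideanSpace ℝ (Fin J ⊕ Fin J) :=
  realRep (received g b n i ω)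

/-- The covariance matrix `E[r̄ r̄ᵀ]` (the samples are identically distributed; sample `0` is
used). -/
def covBar (P : Measure Ω) (g : EuclideanSpace ℂ (Fin J)) (b : ℕ → Ω → ℝ)
    (n : ℕ → Ω → EuclideanSpace ℂ (Fin J)) : Matrix (Fin J ⊕ Fin J) (Fin J ⊕ Fin J) ℝ :=
  Matrix.of fun k l => ∫ ω, rbar g b n 0 ω k * rbar g b n 0 ω l ∂P

/-- The sample covariance matrix `(1/N) ∑ r̄(i) r̄(i)ᵀ` of the first `N` samples. -/
def sampleCovBar (g : EuclideanSpace ℂ (Fin J)) (b : ℕ → Ω → ℝ)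
    (n : ℕ → Ω → EuclideanSpace ℂ (Fin J)) (N : ℕ) (ω : Ω) :
    Matrix (Fin J ⊕ Fin J) (Fin J ⊕ Fin J) ℝ :=
  (1 / (N : ℝ)) • ∑ i ∈ Finset.range N,
    Matrix.vecMulVec (rbar g b n i ω).ofLp (rbar g b n i ω).ofLp

/-- The covariance estimation error `δR̄`. -/
def deltaCovBar (P : Measure Ω) (g : EuclideanSpace ℂ (Fin J)) (b : ℕ → Ω → ℝ)
    (n : ℕ → Ω → EuclideanSpace ℂ (Fin J)) (N : ℕ) (ω : Ω) :
    Matrix (Fin J ⊕ Fin J) (Fin J ⊕ Fin J) ℝ :=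
  sampleCovBar g b n N ω - covBar P g b n

end Estimator

/-- `u` is a unit-norm eigenvector of `A` for the largest eigenvalue of `A`. -/
def IsTopUnitEigenvector {ι : Type*} [Fintype ι] [DecidableEq ι] (A : Matrix ι ι ℝ)
    (u : EuclideanSpace ℝ ι) : Prop :=
  ‖u‖ = 1 ∧ ∃ lam : ℝ,
    IsGreatest {x : ℝ | Module.End.HasEigenvalue (Matrix.toLin' A) x} lam ∧
    Module.End.HasEigenvector (Matrix.toLin' A) lam u.ofLp

section SignCorrection

variable {ι : Type*} [Fintype ι]

/-- The optimal sign `sgn(uᵀ h) ∈ {1, -1}` (with value `1` when `uᵀ h = 0`, where both signs are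
optimal). -/
def optSign (u h : EuclideanSpace ℝ ι) : ℝ := if 0 ≤ inner ℝ u h then 1 else -1

/-- The optimal sign minimizes the distance of the corrected vector to `h` over both signs. -/
theorem optSign_minimizes (u h : EuclideanSpace ℝ ι) (s : ℝ) (hs : s = 1 ∨ s = -1) :
    ‖optSign u h • u - h‖ ^ 2 ≤ ‖s • u - h‖ ^ 2 := by
  have key : ∀ t : ℝ, ‖t • u - h‖ ^ 2 =
      t ^ 2 * ‖u‖ ^ 2 - 2 * (t * inner ℝ u h) + ‖h‖ ^ 2 := by
    intro t
    rw [norm_sub_sq_real, inner_smul_left, norm_smul, mul_pow]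
    simp
  rw [key, key, optSign]
  rcases hs with rfl | rfl <;> split_ifs with h0 <;> nlinarith

/-- The error `δh̄_o = b_o û - h̄` of the optimally sign-corrected estimate. -/
def errorVec (u h : EuclideanSpace ℝ ι) : EuclideanSpace ℝ ι := optSign u h • u - h

/-- The coefficient `μ_o` of the component of the error along the unit vector `h̄`. -/
def errorMu (u h : EuclideanSpace ℝ ι) : ℝ := inner ℝ h (errorVec u h)

/-- The component `q̄_o` of the error orthogonal to the unit vector `h̄`. -/
def errorQ (u h : EuclideanSpace ℝ ι) : EuclideanSpace ℝ ι := errorVec u h - errorMu u h • h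

end SignCorrection

/-- The closed form `(σ²‖g‖²/2 + σ⁴/4) (2J - 1) / (N ‖g‖⁴)`. -/
def mseFormula {J : ℕ} (g : EuclideanSpace ℂ (Fin J)) (σ : ℝ) (N : ℕ) : ℝ :=
  1 / ((N : ℝ) * ‖g‖ ^ 4) * (σ ^ 2 / 2 * ‖g‖ ^ 2 + σ ^ 4 / 4) * (2 * (J : ℝ) - 1)

end SIMO

end

/-! Write `γ = ‖g‖` and `v = σ²/2`. Since `b² = 1`, the outer product of `r̄` equals that of `γ h̄ +
m` with `m = b n̄`, and `m` is again `N(0, v I)` because a centred Gaussian law is even. The sample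
covariance is thus `γ² h̄h̄ᵀ + v I + δR̄`, where `δR̄` comes from a constant signal in white
Gaussian noise.

Part (i) is a covariance computation: split `m` into its component along `h̄` and the independent
orthogonal one (`covariance_signal`), then average `N` independent samples.

For the eigenvector put `B = δR̄/γ²`, let `T` be the squared Frobenius norm of `B`, and let `w` be
the part of `B h̄` orthogonal to `h̄`. Maximality of the eigenvalue gives, with no smallness
assumption and no exceptional event, `‖q‖² ≤ 16 T` and `‖q - w‖² ≤ 144 T²`
(`perturbed_eigenvector_bounds`, `errorQ_bounds`). By (i), `E‖w‖² = F` exactly; a fourth-moment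
bound for independent sums gives `E T² ≤ C F²` with `C` depending only on `J`. Hence `E‖q‖² = F (1 +
o(1))` as `F → 0`, uniformly in all other parameters.

The unit norm and the sign correction give `μ² ≤ ‖q‖⁴`, so `E μ² ≤ 256 C F²` is negligible. This
yields (iii), with Markov's inequality for the probability bound. The mean-square claims of (ii)
follow because `F` is proportional to `1/N`; the almost sure claim follows because `E‖q‖⁴ = O(1/N²)`
is summable. -/

namespace SIMO

open scoped NNReal ENNReal

/-! ### Random variables with finite moments of every order. -/

section Moments

variable {Ω : Type*} [MeasurableSpace Ω]

/-- All moments of `f` are finite. -/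
def HasAllMoments (f : Ω → ℝ) (P : Measure Ω) : Prop := ∀ p : ℝ≥0∞, p ≠ ∞ → MemLp f p P

namespace HasAllMoments

variable {P : Measure Ω} {f g : Ω → ℝ}

theorem add (hf : HasAllMoments f P) (hg : HasAllMoments g P) :
    HasAllMoments (fun ω => f ω + g ω) P := fun p hp => (hf p hp).add (hg p hp)

theorem sub (hf : HasAllMoments f P) (hg : HasAllMoments g P) :
    HasAllMoments (fun ω => f ω - g ω) P := fun p hp => (hf p hp).sub (hg p hp)

theorem mul (hf : HasAllMoments f P) (hg : HasAllMoments g P) :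
    HasAllMoments (fun ω => f ω * g ω) P := fun p hp => by
  have h2 : p * 2 ≠ ∞ := ENNReal.mul_ne_top hp (by simp)
  -- Hölder with `1/(2p) + 1/(2p) = 1/p`; `p = 0` is separate because the inverse of a product needs
  -- a nondegenerate factor.
  have : ENNReal.HolderTriple (p * 2) (p * 2) p := ⟨by
    rcases eq_or_ne p 0 with rfl | h0
    · simp
    · rw [ENNReal.mul_inv (Or.inl h0) (Or.inl hp), ← mul_add, ENNReal.inv_two_add_inv_two, mul_one]⟩
  exact (hg _ h2).mul' (hf _ h2)

theorem const [IsFiniteMeasure P] (c : ℝ) : HasAllMoments (fun _ => c) P :=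
  fun _ _ => memLp_const c

theorem const_mul (hf : HasAllMoments f P) (c : ℝ) : HasAllMoments (fun ω => c * f ω) P :=
  fun p hp => (hf p hp).const_mul c

theorem pow [IsFiniteMeasure P] (hf : HasAllMoments f P) (k : ℕ) :
    HasAllMoments (fun ω => f ω ^ k) P := by
  induction k with
  | zero => simpa using HasAllMoments.const 1
  | succ k ih => simpa [pow_succ] using ih.mul hf

theorem sum {κ : Type*} (s : Finset κ) {f : κ → Ω → ℝ}
    (hf : ∀ i ∈ s, HasAllMoments (f i) P) : HasAllMoments (fun ω => ∑ i ∈ s, f i ω) P :=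
  fun p hp => memLp_finsetSum s fun i hi => hf i hi p hp

theorem integrable (hf : HasAllMoments f P) : Integrable f P :=
  memLp_one_iff_integrable.1 (hf 1 (by simp))

theorem memLp_two (hf : HasAllMoments f P) : MemLp f 2 P := hf 2 (by simp)

end HasAllMoments

end Moments

/-! ### Moments of one-dimensional Gaussians. -/

section RealGaussian

/-- The fourth moment is the fourth derivative at `0` of the moment generating function `exp (v t² /
2)`. -/
theorem integral_pow_four_gaussianReal (v : ℝ≥0) :
    ∫ x, x ^ 4 ∂gaussianReal 0 v = 3 * (v : ℝ) ^ 2 := by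
  have hd (a : ℝ → ℝ) (a' : ℝ → ℝ) (ha : ∀ t, HasDerivAt a (a' t) t) :
      deriv (fun t : ℝ => a t * Real.exp (v * t ^ 2 / 2)) =
        fun t => (a' t + a t * (v * t)) * Real.exp (v * t ^ 2 / 2) := by
    funext t
    have h1 : HasDerivAt (fun t : ℝ => (v : ℝ) * t ^ 2 / 2) (v * t) t := by
      have := (((hasDerivAt_id t).pow 2).const_mul (v : ℝ)).div_const 2
      convert! this using 1
      simp; ring
    have := ((ha t).mul h1.exp).deriv
    rw [show (fun t : ℝ => a t * Real.exp (v * t ^ 2 / 2)) =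
      (a * fun t : ℝ => Real.exp (v * t ^ 2 / 2)) from rfl, this]
    ring
  have h : ∫ x, x ^ 4 ∂gaussianReal 0 v
      = iteratedDeriv 4 (mgf (fun x ↦ x) (gaussianReal 0 v)) 0 := by
    rw [iteratedDeriv_mgf_zero] <;> simp
  have e0 : (fun t : ℝ => Real.exp (0 * t + v * t ^ 2 / 2)) =
      fun t => (1 : ℝ) * Real.exp (v * t ^ 2 / 2) := by
    funext t; simp
  rw [h, mgf_fun_id_gaussianReal, e0, iteratedDeriv_succ', iteratedDeriv_succ', iteratedDeriv_succ',
    iteratedDeriv_succ', iteratedDeriv_zero]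
  rw [hd (fun _ => 1) (fun _ => 0) fun t => hasDerivAt_const t _]
  -- Each polynomial coefficient is `a' + a · (v t)` for the preceding `a`, left in the form in
  -- which `hd` produces it so that the next rewrite matches.
  rw [hd (fun t => 0 + 1 * (v * t)) (fun _ => v) fun t => by
    simpa using (hasDerivAt_id t).const_mul (v : ℝ)]
  rw [hd (fun t => v + (0 + 1 * (v * t)) * (v * t)) (fun t => 2 * v ^ 2 * t) fun t => by
    have h1 := (((hasDerivAt_id t).pow 2).const_mul ((v : ℝ) ^ 2)).const_add (v : ℝ)
    convert! h1 using 1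
    · funext t; simp; ring
    · simp; ring]
  rw [hd (fun t => 2 * v ^ 2 * t + (v + (0 + 1 * (v * t)) * (v * t)) * (v * t))
    (fun t => 3 * v ^ 2 + 3 * v ^ 3 * t ^ 2) fun t => by
    have h1 := ((hasDerivAt_id t).const_mul (3 * (v : ℝ) ^ 2)).add
      (((hasDerivAt_id t).pow 3).const_mul ((v : ℝ) ^ 3))
    convert! h1 using 1
    · funext t; simp; ring
    · simp; ring]
  simp

theorem integral_pow_three_gaussianReal (v : ℝ≥0) :
    ∫ x, x ^ 3 ∂gaussianReal 0 v = 0 := by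
  have h : ∫ x, x ^ 3 ∂gaussianReal 0 v = ∫ x, x ^ 3 ∂(gaussianReal 0 v).map (fun x => -x) := by
    rw [gaussianReal_map_neg, neg_zero]
  rw [integral_map (by fun_prop) (by fun_prop)] at h
  have : ∀ x : ℝ, (-x) ^ 3 = -(x ^ 3) := fun x => by ring
  simp only [this, integral_neg] at h
  linarith

/-- Scaling to unit variance isolates the dependence on `v`, so the eighth moment can enter later
bounds as an unevaluated constant. -/
theorem integral_pow_gaussianReal_eq (v : ℝ≥0) (k : ℕ) :
    ∫ x, x ^ k ∂gaussianReal 0 v = (√v) ^ k * ∫ x, x ^ k ∂gaussianReal 0 1 := by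
  have h := gaussianReal_map_const_mul (μ := 0) (v := 1) (√(v : ℝ))
  have e : gaussianReal (√(v : ℝ) * 0) (NNReal.mk (√(v : ℝ) ^ 2) (sq_nonneg _) * 1) = gaussianReal 0 v := by
    have hv : NNReal.mk (√(v : ℝ) ^ 2) (sq_nonneg _) = v := NNReal.eq (Real.sq_sqrt v.coe_nonneg)
    rw [hv, mul_zero, mul_one]
  rw [e] at h
  rw [← h, integral_map (by fun_prop) (by fun_prop)]
  simp only [mul_pow, integral_const_mul]

end RealGaussian

/-! ### White Gaussian vectors and the covariance of the signal-direction samples. -/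

section IsotropicGaussian

theorem posSemidef_smul_one {ι : Type*} [DecidableEq ι] {v : ℝ} (hv : 0 ≤ v) :
    (v • (1 : Matrix ι ι ℝ)).PosSemidef :=
  Matrix.PosSemidef.one.smul hv

variable {ι : Type*} [Fintype ι] [DecidableEq ι] {Ω : Type*} [MeasurableSpace Ω]

/-- `X` is a centred Gaussian vector with covariance matrix `v • 1`. -/
structure IsIsotropicGaussian (P : Measure Ω) (v : ℝ) (X : Ω → EuclideanSpace ℝ ι) : Prop where
  nonneg : 0 ≤ v
  measurable : Measurable X
  map_eq : P.map X = multivariateGaussian 0 (v • (1 : Matrix ι ι ℝ))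

variable {P : Measure Ω} {v : ℝ} {X : Ω → EuclideanSpace ℝ ι}

namespace IsIsotropicGaussian

theorem hasGaussianLaw (hX : IsIsotropicGaussian P v X) : HasGaussianLaw X P :=
  HasLaw.hasGaussianLaw ⟨hX.measurable.aemeasurable, hX.map_eq⟩

theorem hasGaussianLaw_inner (hX : IsIsotropicGaussian P v X) (a : EuclideanSpace ℝ ι) :
    HasGaussianLaw (fun ω => inner ℝ a (X ω)) P :=
  hX.hasGaussianLaw.map_fun (innerSL ℝ a)

theorem integral_inner (hX : IsIsotropicGaussian P v X) (a : EuclideanSpace ℝ ι) :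
    ∫ ω, inner ℝ a (X ω) ∂P = 0 := by
  have h1 : ∫ ω, X ω ∂P = 0 := by
    rw [← integral_map (f := fun x => x) hX.measurable.aemeasurable (by fun_prop), hX.map_eq]
    simp
  have := (innerSL ℝ a).integral_comp_comm hX.hasGaussianLaw.integrable
  simp only [innerSL_apply_apply] at this
  rw [this, h1, inner_zero_right]

theorem covariance_inner (hX : IsIsotropicGaussian P v X) (a c : EuclideanSpace ℝ ι) :
    cov[fun ω => inner ℝ a (X ω), fun ω => inner ℝ c (X ω); P] = v * inner ℝ a c := by
  have h1 := covariance_map_fun (μ := P) (Z := X) (X := fun x => inner ℝ a x)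
    (Y := fun x => inner ℝ c x) (by fun_prop) (by fun_prop) hX.measurable.aemeasurable
  rw [← h1, hX.map_eq, ← covarianceBilin_apply_eq_cov IsGaussian.memLp_two_id,
    covarianceBilin_multivariateGaussian (posSemidef_smul_one hX.nonneg),
    Matrix.smul_mulVec, Matrix.one_mulVec, dotProduct_smul, smul_eq_mul]
  rw [EuclideanSpace.inner_eq_star_dotProduct, dotProduct_comm]
  simp

theorem integral_inner_mul_inner [IsProbabilityMeasure P] (hX : IsIsotropicGaussian P v X)
    (a c : EuclideanSpace ℝ ι) :
    ∫ ω, inner ℝ a (X ω) * inner ℝ c (X ω) ∂P = v * inner ℝ a c := by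
  rw [← hX.covariance_inner, covariance_eq_sub (hX.hasGaussianLaw_inner a).memLp_two
    (hX.hasGaussianLaw_inner c).memLp_two, hX.integral_inner, zero_mul, sub_zero]
  rfl

theorem map_inner (hX : IsIsotropicGaussian P v X) (a : EuclideanSpace ℝ ι) (ha : ‖a‖ = 1) :
    P.map (fun ω => inner ℝ a (X ω)) = gaussianReal 0 v.toNNReal := by
  rw [(hX.hasGaussianLaw_inner a).map_eq_gaussianReal, hX.integral_inner,
    ← covariance_self (hX.hasGaussianLaw_inner a).aemeasurable, hX.covariance_inner,
    real_inner_self_eq_norm_sq, ha]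
  simp

theorem integral_inner_pow (hX : IsIsotropicGaussian P v X) (a : EuclideanSpace ℝ ι)
    (ha : ‖a‖ = 1) (k : ℕ) :
    ∫ ω, inner ℝ a (X ω) ^ k ∂P = ∫ x, x ^ k ∂gaussianReal 0 v.toNNReal := by
  rw [← hX.map_inner a ha, integral_map (hX.hasGaussianLaw_inner a).aemeasurable (by fun_prop)]

/-- The component along a unit vector and the orthogonal component are independent. -/
theorem indepFun_inner_orthogonal (hX : IsIsotropicGaussian P v X) (h : EuclideanSpace ℝ ι)
    (hh : ‖h‖ = 1) :
    IndepFun (fun ω => inner ℝ h (X ω)) (fun ω => X ω - inner ℝ h (X ω) • h) P := by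
  have hg : HasGaussianLaw (fun ω => (inner ℝ h (X ω), X ω - inner ℝ h (X ω) • h)) P :=
    hX.hasGaussianLaw.map_fun ((innerSL ℝ h).prod
      (ContinuousLinearMap.id ℝ _ - (innerSL ℝ h).smulRight h))
  -- The pair is jointly Gaussian, so vanishing covariances suffice; they vanish because `x • h` is
  -- orthogonal to `y - ⟨y, h⟩ h`.
  refine hg.indepFun_of_covariance_inner fun x y => ?_
  have e1 : (fun ω => inner ℝ x (inner ℝ h (X ω))) = fun ω => inner ℝ (x • h) (X ω) := by
    funext ω; simp [real_inner_smul_left, mul_comm]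
  have e2 : (fun ω => inner ℝ y (X ω - inner ℝ h (X ω) • h)) =
      fun ω => inner ℝ (y - inner ℝ y h • h) (X ω) := by
    funext ω
    simp only [inner_sub_left, inner_sub_right, real_inner_smul_left, real_inner_smul_right]
    ring
  rw [e1, e2, hX.covariance_inner]
  simp only [inner_sub_right, real_inner_smul_right,
    real_inner_self_eq_norm_sq, hh, real_inner_comm]
  ring

theorem hasAllMoments_inner (hX : IsIsotropicGaussian P v X) (a : EuclideanSpace ℝ ι) :
    HasAllMoments (fun ω => inner ℝ a (X ω)) P :=
  fun _ hp => (hX.hasGaussianLaw_inner a).memLp hp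

theorem inner_single (X : EuclideanSpace ℝ ι) (k : ι) :
    inner ℝ (EuclideanSpace.single k (1 : ℝ)) X = X k := by
  simp [EuclideanSpace.inner_single_left]

theorem hasAllMoments_apply (hX : IsIsotropicGaussian P v X) (k : ι) :
    HasAllMoments (fun ω => X ω k) P := by
  simpa only [inner_single] using hX.hasAllMoments_inner (EuclideanSpace.single k 1)

theorem integral_apply (hX : IsIsotropicGaussian P v X) (k : ι) :
    ∫ ω, X ω k ∂P = 0 := by
  simpa only [inner_single] using hX.integral_inner (EuclideanSpace.single k 1)

theorem integral_apply_mul_apply [IsProbabilityMeasure P] (hX : IsIsotropicGaussian P v X)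
    (k l : ι) : ∫ ω, X ω k * X ω l ∂P = v * (1 : Matrix ι ι ℝ) k l := by
  have := hX.integral_inner_mul_inner (EuclideanSpace.single k 1) (EuclideanSpace.single l 1)
  simp only [inner_single] at this
  rw [this]
  simp [Matrix.one_apply]

theorem integral_apply_pow (hX : IsIsotropicGaussian P v X) (k : ι) (j : ℕ) :
    ∫ ω, X ω k ^ j ∂P = (√v) ^ j * ∫ x, x ^ j ∂gaussianReal 0 1 := by
  have := hX.integral_inner_pow (EuclideanSpace.single k 1) (by simp) j
  simp only [inner_single] at this
  rw [this, integral_pow_gaussianReal_eq, Real.coe_toNNReal _ hX.nonneg]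

/-- Covariances of the entries of `(γ h + X) ⟨γ h + X, h⟩` for a unit vector `h`. -/
theorem covariance_signal [IsProbabilityMeasure P] (hX : IsIsotropicGaussian P v X)
    (h : EuclideanSpace ℝ ι) (hh : ‖h‖ = 1) (γ : ℝ) (k l : ι) :
    cov[fun ω => (γ * h k + X ω k) * (γ + inner ℝ h (X ω)),
      fun ω => (γ * h l + X ω l) * (γ + inner ℝ h (X ω)); P] =
    (3 * γ ^ 2 * v + v ^ 2) * (h k * h l) + (γ ^ 2 * v + v ^ 2) * (1 : Matrix ι ι ℝ) k l := by
  set x : Ω → ℝ := fun ω => inner ℝ h (X ω) with hx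
  set p : ι → Ω → ℝ := fun j ω => X ω j - x ω * h j with hp
  have mx : HasAllMoments x P := hX.hasAllMoments_inner h
  have mp (j : ι) : HasAllMoments (p j) P :=
    (hX.hasAllMoments_apply j).sub (mx.mul (HasAllMoments.const (h j)))
  have mg : HasAllMoments (fun ω => γ + x ω) P := (HasAllMoments.const γ).add mx
  -- Every expectation below factors into a moment of the parallel component `x` and one of the
  -- orthogonal component `p`.
  have hind (f : ℝ → ℝ) (hf : Measurable f) (g : EuclideanSpace ℝ ι → ℝ) (hg : Measurable g) :
      ∫ ω, f (x ω) * g (X ω - x ω • h) ∂P = (∫ ω, f (x ω) ∂P) * ∫ ω, g (X ω - x ω • h) ∂P := by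
    have hi := (hX.indepFun_inner_orthogonal h hh).comp hf hg
    have hxm : Measurable x := (by fun_prop : Measurable fun y => inner ℝ h y).comp hX.measurable
    exact hi.integral_mul_eq_mul_integral (hf.comp hxm).aestronglyMeasurable
      (hg.comp (hX.measurable.sub (hxm.smul_const h))).aestronglyMeasurable
  have x1 : ∫ ω, x ω ∂P = 0 := hX.integral_inner h
  have x2 : ∫ ω, x ω ^ 2 ∂P = v := by
    simp only [sq, hx, hX.integral_inner_mul_inner, real_inner_self_eq_norm_sq, hh]; simp
  have x3 : ∫ ω, x ω ^ 3 ∂P = 0 := by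
    rw [hX.integral_inner_pow h hh, integral_pow_three_gaussianReal]
  have x4 : ∫ ω, x ω ^ 4 ∂P = 3 * v ^ 2 := by
    rw [hX.integral_inner_pow h hh, integral_pow_four_gaussianReal, Real.coe_toNNReal _ hX.nonneg]
  have p1 (j : ι) : ∫ ω, p j ω ∂P = 0 := by
    simp only [hp]
    rw [integral_sub (hX.hasAllMoments_apply j).integrable (mx.integrable.mul_const _),
      integral_mul_const, x1, hX.integral_apply]
    simp
  have xk (j : ι) : ∫ ω, X ω j * x ω ∂P = v * h j := by
    have := hX.integral_inner_mul_inner (EuclideanSpace.single j 1) h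
    simpa only [inner_single] using this
  have p2 : ∫ ω, p k ω * p l ω ∂P = v * ((1 : Matrix ι ι ℝ) k l - h k * h l) := by
    have e : ∀ ω, p k ω * p l ω =
        (X ω k * X ω l - h l * (X ω k * x ω)) - (h k * (X ω l * x ω) - (h k * h l) * x ω ^ 2) :=
      fun ω => by simp only [hp]; ring
    have i1 := ((hX.hasAllMoments_apply k).mul (hX.hasAllMoments_apply l))
    have i2 := (((hX.hasAllMoments_apply k).mul mx).const_mul (h l))
    have i3 := (((hX.hasAllMoments_apply l).mul mx).const_mul (h k))
    have i4 := ((mx.pow 2).const_mul (h k * h l))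
    simp only [e]
    rw [integral_sub (i1.sub i2).integrable (i3.sub i4).integrable,
      integral_sub i1.integrable i2.integrable, integral_sub i3.integrable i4.integrable,
      integral_const_mul, integral_const_mul, integral_const_mul, xk, xk, x2,
      hX.integral_apply_mul_apply]
    ring
  have g2 : ∫ ω, (γ + x ω) ^ 2 ∂P = γ ^ 2 + v := by
    have e : ∀ ω, (γ + x ω) ^ 2 = γ ^ 2 + (2 * γ * x ω + x ω ^ 2) := fun ω => by ring
    simp only [e]
    rw [integral_add (integrable_const _)
      ((mx.const_mul (2 * γ)).add (mx.pow 2)).integrable,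
      integral_add (mx.const_mul (2 * γ)).integrable (mx.pow 2).integrable, integral_const_mul,
      x1, x2]
    simp
  have g4 : ∫ ω, (γ + x ω) ^ 4 ∂P = γ ^ 4 + 6 * γ ^ 2 * v + 3 * v ^ 2 := by
    have e : ∀ ω, (γ + x ω) ^ 4 = (γ ^ 4 + 4 * γ ^ 3 * x ω) +
        ((6 * γ ^ 2 * x ω ^ 2 + 4 * γ * x ω ^ 3) + x ω ^ 4) := fun ω => by ring
    have j1 := (HasAllMoments.const (P := P) (γ ^ 4))
    have j2 := (mx.const_mul (4 * γ ^ 3))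
    have j3 := ((mx.pow 2).const_mul (6 * γ ^ 2))
    have j4 := ((mx.pow 3).const_mul (4 * γ))
    have j5 := (mx.pow 4)
    simp only [e]
    rw [integral_add (j1.add j2).integrable ((j3.add j4).add j5).integrable,
      integral_add j1.integrable j2.integrable, integral_add (j3.add j4).integrable j5.integrable,
      integral_add j3.integrable j4.integrable, integral_const_mul, integral_const_mul,
      integral_const_mul, x1, x2, x3, x4]
    simp
    ring
  have gp1 (n : ℕ) (j : ι) : ∫ ω, (γ + x ω) ^ n * p j ω ∂P = 0 := by
    have := hind (fun t => (γ + t) ^ n) (by fun_prop) (fun y => y j) (by fun_prop)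
    simp only [PiLp.sub_apply, PiLp.smul_apply, smul_eq_mul] at this
    simp only [hp] at p1 ⊢
    rw [this, p1, mul_zero]
  have gp2 : ∫ ω, (γ + x ω) ^ 2 * (p k ω * p l ω) ∂P =
      (γ ^ 2 + v) * (v * ((1 : Matrix ι ι ℝ) k l - h k * h l)) := by
    have := hind (fun t => (γ + t) ^ 2) (by fun_prop) (fun y => y k * y l) (by fun_prop)
    simp only [PiLp.sub_apply, PiLp.smul_apply, smul_eq_mul] at this
    rw [← p2, ← g2]
    exact this
  -- With `X = x h + p`, the entry is `h_j (γ + x)² + (γ + x) p_j`. Terms linear in `p` have mean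
  -- zero, which leaves `g4` and `gp2`. The exponent `1` is kept so that `gp1` applies.
  have eY (j : ι) : (fun ω => (γ * h j + X ω j) * (γ + x ω)) =
      fun ω => h j * (γ + x ω) ^ 2 + (γ + x ω) ^ 1 * p j ω := by
    funext ω; simp only [hp]; ring
  have mY (j : ι) : HasAllMoments (fun ω => h j * (γ + x ω) ^ 2 + (γ + x ω) ^ 1 * p j ω) P :=
    ((mg.pow 2).const_mul _).add ((mg.pow 1).mul (mp j))
  have EY (j : ι) : ∫ ω, (h j * (γ + x ω) ^ 2 + (γ + x ω) ^ 1 * p j ω) ∂P =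
      h j * (γ ^ 2 + v) := by
    rw [integral_add ((mg.pow 2).const_mul _).integrable ((mg.pow 1).mul (mp j)).integrable,
      integral_const_mul, g2, gp1, add_zero]
  have EYY : ∫ ω, (h k * (γ + x ω) ^ 2 + (γ + x ω) ^ 1 * p k ω) *
      (h l * (γ + x ω) ^ 2 + (γ + x ω) ^ 1 * p l ω) ∂P =
      h k * h l * (γ ^ 4 + 6 * γ ^ 2 * v + 3 * v ^ 2) +
        (γ ^ 2 + v) * (v * ((1 : Matrix ι ι ℝ) k l - h k * h l)) := by
    have e : ∀ ω, (h k * (γ + x ω) ^ 2 + (γ + x ω) ^ 1 * p k ω) *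
        (h l * (γ + x ω) ^ 2 + (γ + x ω) ^ 1 * p l ω) =
        (h k * h l * (γ + x ω) ^ 4 + h k * ((γ + x ω) ^ 3 * p l ω)) +
          (h l * ((γ + x ω) ^ 3 * p k ω) + (γ + x ω) ^ 2 * (p k ω * p l ω)) := fun ω => by ring
    have j1 := ((mg.pow 4).const_mul (h k * h l))
    have j2 := (((mg.pow 3).mul (mp l)).const_mul (h k))
    have j3 := (((mg.pow 3).mul (mp k)).const_mul (h l))
    have j4 := ((mg.pow 2).mul ((mp k).mul (mp l)))
    simp only [e]
    rw [integral_add (j1.add j2).integrable (j3.add j4).integrable,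
      integral_add j1.integrable j2.integrable, integral_add j3.integrable j4.integrable,
      integral_const_mul, integral_const_mul, integral_const_mul, gp1, gp1, gp2, g4]
    ring
  rw [eY, eY, covariance_eq_sub (mY k).memLp_two (mY l).memLp_two]
  simp only [Pi.mul_apply]
  rw [EYY, EY, EY]
  ring

end IsIsotropicGaussian

end IsotropicGaussian

/-! ### Fourth moments and covariances of sums of independent variables. -/

section IndependentSums

variable {Ω : Type*} [MeasurableSpace Ω] {P : Measure Ω} [IsProbabilityMeasure P]

/-- Nonnegativity of the variance of `f²`. -/
theorem sq_integral_sq_le {f : Ω → ℝ} (hf : HasAllMoments f P) :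
    (∫ ω, f ω ^ 2 ∂P) ^ 2 ≤ ∫ ω, f ω ^ 4 ∂P := by
  have h := variance_nonneg (fun ω => f ω ^ 2) P
  rw [variance_eq_sub (hf.pow 2).memLp_two] at h
  have e : ∫ ω, ((fun ω => f ω ^ 2) ^ 2) ω ∂P = ∫ ω, f ω ^ 4 ∂P := by
    congr 1 with ω
    simp only [Pi.pow_apply]; ring
  rw [e] at h
  linarith

/-- The fourth moment of a sum of `N` independent centred random variables with fourth moment at
most `M` is at most `3 N² M`. -/
theorem integral_sum_pow_four_le {X : ℕ → Ω → ℝ} (hm : ∀ i, HasAllMoments (X i) P)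
    (hmeas : ∀ i, Measurable (X i)) (hind : iIndepFun X P) (h0 : ∀ i, ∫ ω, X i ω ∂P = 0) {M : ℝ}
    (hM : ∀ i, ∫ ω, X i ω ^ 4 ∂P ≤ M) (N : ℕ) :
    ∫ ω, (∑ i ∈ Finset.range N, X i ω) ^ 4 ∂P ≤ 3 * (N : ℝ) ^ 2 * M := by
  have hM0 : 0 ≤ M := (integral_nonneg fun ω => by positivity).trans (hM 0)
  have hK (i : ℕ) : ∫ ω, X i ω ^ 2 ∂P ≤ √M :=
    Real.le_sqrt_of_sq_le ((sq_integral_sq_le (hm i)).trans (hM i))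
  have hKM : √M * √M = M := Real.mul_self_sqrt hM0
  have mS (n : ℕ) : HasAllMoments (fun ω => ∑ i ∈ Finset.range n, X i ω) P :=
    HasAllMoments.sum _ fun i _ => hm i
  have measS (n : ℕ) : Measurable (fun ω => ∑ i ∈ Finset.range n, X i ω) :=
    Finset.measurable_sum _ fun i _ => hmeas i
  have key (n j k : ℕ) :
      ∫ ω, (∑ i ∈ Finset.range n, X i ω) ^ j * X n ω ^ k ∂P =
        (∫ ω, (∑ i ∈ Finset.range n, X i ω) ^ j ∂P) * ∫ ω, X n ω ^ k ∂P := by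
    have h1 : IndepFun (fun ω => ∑ i ∈ Finset.range n, X i ω) (X n) P := by
      have := hind.indepFun_finsetSum_of_notMem hmeas (s := Finset.range n) (i := n) (by simp)
      convert this using 1
      funext ω; simp
    exact (h1.comp (measurable_id.pow_const j) (measurable_id.pow_const k)
      ).integral_mul_eq_mul_integral ((measS n).pow_const j).aestronglyMeasurable
        ((hmeas n).pow_const k).aestronglyMeasurable
  have S1 (n : ℕ) : ∫ ω, ∑ i ∈ Finset.range n, X i ω ∂P = 0 := by
    rw [integral_finsetSum _ fun i _ => (hm i).integrable]
    simp [h0]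
  have S2 (n : ℕ) : ∫ ω, (∑ i ∈ Finset.range n, X i ω) ^ 2 ∂P ≤ n * √M := by
    induction n with
    | zero => simp
    | succ n ih =>
      have e : ∀ ω, (∑ i ∈ Finset.range (n + 1), X i ω) ^ 2 =
          ((∑ i ∈ Finset.range n, X i ω) ^ 2 +
            2 * ((∑ i ∈ Finset.range n, X i ω) ^ 1 * X n ω ^ 1)) + X n ω ^ 2 := fun ω => by
        rw [Finset.sum_range_succ]; ring
      have j1 := (mS n).pow 2
      have j2 := (((mS n).pow 1).mul ((hm n).pow 1)).const_mul 2
      have j3 := (hm n).pow 2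
      simp only [e]
      rw [integral_add (j1.add j2).integrable j3.integrable,
        integral_add j1.integrable j2.integrable, integral_const_mul, key]
      simp only [pow_one, S1, zero_mul, mul_zero, add_zero]
      have := hK n
      push_cast
      linarith
  induction N with
  | zero => simp
  | succ n ih =>
    have e : ∀ ω, (∑ i ∈ Finset.range (n + 1), X i ω) ^ 4 =
        (((∑ i ∈ Finset.range n, X i ω) ^ 4 +
          4 * ((∑ i ∈ Finset.range n, X i ω) ^ 3 * X n ω ^ 1)) +
        (6 * ((∑ i ∈ Finset.range n, X i ω) ^ 2 * X n ω ^ 2) +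
          4 * ((∑ i ∈ Finset.range n, X i ω) ^ 1 * X n ω ^ 3))) + X n ω ^ 4 := fun ω => by
      rw [Finset.sum_range_succ]; ring
    have j1 := (mS n).pow 4
    have j2 := (((mS n).pow 3).mul ((hm n).pow 1)).const_mul 4
    have j3 := (((mS n).pow 2).mul ((hm n).pow 2)).const_mul 6
    have j4 := (((mS n).pow 1).mul ((hm n).pow 3)).const_mul 4
    have j5 := (hm n).pow 4
    simp only [e]
    rw [integral_add ((j1.add j2).add (j3.add j4)).integrable j5.integrable,
      integral_add (j1.add j2).integrable (j3.add j4).integrable,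
      integral_add j1.integrable j2.integrable, integral_add j3.integrable j4.integrable,
      integral_const_mul, integral_const_mul, integral_const_mul, key, key, key]
    simp only [pow_one, S1, h0, zero_mul, mul_zero, add_zero]
    -- The odd cross terms vanish, so the recursion adds at most `6 n M + M`, and `3 n² + 6 n + 1 ≤
    -- 3 (n + 1)²`.
    have h2 : (∫ ω, (∑ i ∈ Finset.range n, X i ω) ^ 2 ∂P) * ∫ ω, X n ω ^ 2 ∂P ≤ n * M := by
      calc _ ≤ (n * √M) * √M :=
            mul_le_mul (S2 n) (hK n) (integral_nonneg fun ω => by positivity) (by positivity)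
        _ = n * M := by rw [mul_assoc, hKM]
    have := hM n
    push_cast
    nlinarith

/-- Covariances of sums of independent identically correlated pairs. -/
theorem covariance_sum_of_indep {κ : Type*} {Y : κ → ℕ → Ω → ℝ}
    (hm : ∀ k i, HasAllMoments (Y k i) P) {c : ℝ} (k l : κ)
    (hind : ∀ i j, i ≠ j → IndepFun (Y k i) (Y l j) P)
    (hc : ∀ i, cov[Y k i, Y l i; P] = c) (N : ℕ) :
    cov[fun ω => ∑ i ∈ Finset.range N, Y k i ω, fun ω => ∑ i ∈ Finset.range N, Y l i ω; P] =
      N * c := by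
  rw [covariance_fun_sum_fun_sum' (fun i _ => (hm k i).memLp_two) fun i _ => (hm l i).memLp_two]
  have : ∀ i ∈ Finset.range N, ∑ j ∈ Finset.range N, cov[Y k i, Y l j; P] = c := by
    intro i hi
    rw [Finset.sum_eq_single i _ (fun h => absurd hi h), hc]
    intro j _ hji
    exact (hind i j hji.symm).covariance_eq_zero (hm k i).memLp_two (hm l j).memLp_two
  rw [Finset.sum_congr rfl this]
  simp

end IndependentSums

/-! ### Deterministic perturbation of the leading eigenvector. -/

section Perturbation

theorem norm_sub_inner_smul_le {E : Type*} [NormedAddCommGroup E] [InnerProductSpace ℝ E]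
    {h : E} (hh : ‖h‖ = 1) (x : E) : ‖x - inner ℝ h x • h‖ ≤ ‖x‖ := by
  have h1 : ‖x - inner ℝ h x • h‖ ^ 2 = ‖x‖ ^ 2 - inner ℝ h x ^ 2 := by
    rw [norm_sub_sq_real, norm_smul, real_inner_smul_right, hh, Real.norm_eq_abs, mul_one, sq_abs,
      real_inner_comm]
    ring
  exact le_of_sq_le_sq (by rw [h1]; nlinarith [sq_nonneg (inner ℝ h x)]) (norm_nonneg _)

/-- First-order perturbation of the leading eigenvector of a rank-one projection. -/
theorem perturbed_eigenvector_bounds {E : Type*} [NormedAddCommGroup E] [InnerProductSpace ℝ E]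
    {h e : E} (hh : ‖h‖ = 1) (he : ‖e‖ = 1) (D : E →ₗ[ℝ] E) {δ : ℝ} (hδ : 0 ≤ δ)
    (hD : ∀ x, ‖D x‖ ≤ δ * ‖x‖) {κ : ℝ} (hc : 0 ≤ inner ℝ h e)
    (heig : inner ℝ h e • h + D e = κ • e) (hκ : 1 + inner ℝ h (D h) ≤ κ) :
    ‖e - inner ℝ h e • h‖ ≤ 4 * δ ∧
    ‖(e - inner ℝ h e • h) - (D h - inner ℝ h (D h) • h)‖ ≤ 12 * δ ^ 2 := by
  set c : ℝ := inner ℝ h e with hcdef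
  set q := e - c • h with hq
  set w := D h - inner ℝ h (D h) • h with hw
  have hDh : ‖D h‖ ≤ δ := by simpa [hh] using hD h
  have hDe : ‖D e‖ ≤ δ := by simpa [he] using hD e
  have hq2 : ‖q‖ ^ 2 = 1 - c ^ 2 := by
    rw [hq, norm_sub_sq_real, norm_smul, real_inner_smul_right, hh, he, Real.norm_eq_abs, mul_one,
      sq_abs, real_inner_comm]
    ring
  have hc1 : c ≤ 1 := by nlinarith [sq_nonneg ‖q‖]
  have hq1 : ‖q‖ ≤ 1 := by nlinarith [norm_nonneg q]
  -- Together with `hκ2` this places the eigenvalue within `δ` of `1`: the lower bound uses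
  -- maximality through `hκ`, the upper one the quadratic form at `e` and `c ≤ 1`.
  have hκ1 : 1 - δ ≤ κ := by
    have := (abs_le.1 (abs_real_inner_le_norm h (D h))).1
    rw [hh, one_mul] at this
    linarith
  have hκ2 : κ ≤ 1 + δ := by
    have h1 : inner ℝ e (c • h + D e) = κ := by
      rw [heig, real_inner_smul_right, real_inner_self_eq_norm_sq, he]; ring
    rw [inner_add_right, real_inner_smul_right, real_inner_comm, ← hcdef] at h1
    have := (abs_le.1 (abs_real_inner_le_norm e (D e))).2
    rw [he, one_mul] at this
    nlinarith
  -- Projecting the eigenvalue equation orthogonally to `h` removes the unperturbed rank-one term.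
  have hPe : κ • q = D e - inner ℝ h (D e) • h := by
    have h1 : inner ℝ h (c • h + D e) = κ * c := by rw [heig, real_inner_smul_right]
    rw [inner_add_right, real_inner_smul_right, real_inner_self_eq_norm_sq, hh] at h1
    have h2 : inner ℝ h (D e) = κ * c - c := by linarith
    rw [h2, hq, smul_sub, ← heig, smul_smul, sub_smul]
    abel
  have hsplit : κ • q = c • w + (D q - inner ℝ h (D q) • h) := by
    have h3 : D e = c • D h + D q := by
      rw [← map_smul, ← map_add, hq]; congr 1; abel
    rw [hPe, h3, inner_add_right, real_inner_smul_right, hw, smul_sub, smul_smul, add_smul]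
    abel
  have hq4 : ‖q‖ ≤ 4 * δ := by
    -- For `δ ≥ 1/4` the claim is weaker than `‖q‖ ≤ 1`; otherwise `κ > 3/4` and the projected
    -- equation can be divided by `κ`. This is why no smallness hypothesis on `δ` is needed.
    rcases le_or_gt (1 / 4) δ with h4 | h4
    · linarith
    · have h5 : ‖κ • q‖ ≤ δ := by
        rw [hPe]; exact (norm_sub_inner_smul_le hh _).trans hDe
      rw [norm_smul, Real.norm_eq_abs, abs_of_pos (by linarith)] at h5
      nlinarith [norm_nonneg q]
  refine ⟨hq4, ?_⟩
  have hw1 : ‖w‖ ≤ δ := (norm_sub_inner_smul_le hh _).trans hDh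
  -- Each of the three terms is at most `δ ‖q‖`, and `‖q‖ ≤ 4 δ` turns `3 δ ‖q‖` into `12 δ²`.
  have hid : q - w = (c - 1) • w + (D q - inner ℝ h (D q) • h) - (κ - 1) • q := by
    rw [sub_smul, sub_smul, hsplit, one_smul, one_smul]; abel
  have b1 : ‖(c - 1) • w‖ ≤ δ * ‖q‖ := by
    rw [norm_smul, Real.norm_eq_abs, abs_of_nonpos (by linarith)]
    -- Since `0 ≤ c ≤ 1` and `‖q‖ ≤ 1`: `1 - c ≤ 1 - c² = ‖q‖² ≤ ‖q‖`.
    have : 1 - c ≤ ‖q‖ := by nlinarith [norm_nonneg q]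
    calc -(c - 1) * ‖w‖ ≤ ‖q‖ * δ :=
          mul_le_mul (by linarith) hw1 (norm_nonneg _) (norm_nonneg _)
      _ = _ := mul_comm _ _
  have b2 : ‖D q - inner ℝ h (D q) • h‖ ≤ δ * ‖q‖ := (norm_sub_inner_smul_le hh _).trans (hD q)
  have b3 : ‖(κ - 1) • q‖ ≤ δ * ‖q‖ := by
    rw [norm_smul, Real.norm_eq_abs]
    exact mul_le_mul_of_nonneg_right (abs_le.2 ⟨by linarith, by linarith⟩) (norm_nonneg _)
  calc ‖q - w‖ ≤ ‖(c - 1) • w‖ + ‖D q - inner ℝ h (D q) • h‖ + ‖(κ - 1) • q‖ := by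
        rw [hid]
        exact (norm_sub_le _ _).trans (add_le_add_left (norm_add_le _ _) _)
    _ ≤ 3 * (δ * ‖q‖) := by linarith
    _ ≤ 12 * δ ^ 2 := by nlinarith

variable {ι : Type*} [Fintype ι]

section SignCorrection

variable {u h : EuclideanSpace ℝ ι}

theorem norm_optSign_smul (u h : EuclideanSpace ℝ ι) : ‖optSign u h • u‖ = ‖u‖ := by
  unfold optSign; split_ifs <;> simp

theorem inner_optSign_smul_nonneg (u h : EuclideanSpace ℝ ι) : 0 ≤ inner ℝ h (optSign u h • u) := by
  rw [real_inner_smul_right, real_inner_comm]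
  unfold optSign
  split_ifs with h0
  · simpa using h0
  · push Not at h0
    linarith

theorem errorMu_eq (hh : ‖h‖ = 1) : errorMu u h = inner ℝ h (optSign u h • u) - 1 := by
  rw [errorMu, errorVec, inner_sub_right, real_inner_self_eq_norm_sq, hh, one_pow]

theorem errorQ_eq (hh : ‖h‖ = 1) :
    errorQ u h = optSign u h • u - inner ℝ h (optSign u h • u) • h := by
  rw [errorQ, errorMu_eq hh, errorVec, sub_smul, one_smul]; abel

theorem norm_errorQ_sq (hh : ‖h‖ = 1) (hu : ‖u‖ = 1) :
    ‖errorQ u h‖ ^ 2 = 1 - inner ℝ h (optSign u h • u) ^ 2 := by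
  rw [errorQ_eq hh, norm_sub_sq_real, norm_optSign_smul, norm_smul, real_inner_smul_right, hh, hu,
    Real.norm_eq_abs, mul_one, sq_abs, real_inner_comm]
  ring

/-- With `c = ⟨h, b u⟩`, which the sign correction makes nonnegative, `|μ| = 1 - c ≤ (1 - c)(1 + c)
= ‖q‖²`. Negligibility of `μ` always comes from this inequality. -/
theorem abs_errorMu_sq_le (hh : ‖h‖ = 1) (hu : ‖u‖ = 1) :
    |errorMu u h| ^ 2 ≤ ‖errorQ u h‖ ^ 4 := by
  have h1 := norm_errorQ_sq hh hu
  have h0 := inner_optSign_smul_nonneg u h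
  have h2 : ‖errorQ u h‖ ^ 4 = (‖errorQ u h‖ ^ 2) ^ 2 := by ring
  have h3 := sq_nonneg ‖errorQ u h‖
  rw [sq_abs, h2, errorMu_eq hh, ← neg_sq]
  refine pow_le_pow_left₀ ?_ ?_ 2 <;> nlinarith

theorem norm_errorVec_sq (hh : ‖h‖ = 1) :
    ‖errorVec u h‖ ^ 2 = ‖errorQ u h‖ ^ 2 + |errorMu u h| ^ 2 := by
  rw [errorQ, norm_sub_sq_real, norm_smul, real_inner_smul_right, hh, Real.norm_eq_abs, mul_one,
    sq_abs, real_inner_comm, ← errorMu]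
  ring

theorem norm_errorQ_le_one (hh : ‖h‖ = 1) (hu : ‖u‖ = 1) : ‖errorQ u h‖ ≤ 1 := by
  have := norm_errorQ_sq hh hu
  nlinarith [norm_nonneg (errorQ u h), sq_nonneg (inner ℝ h (optSign u h • u))]

theorem measurable_errorVec (h : EuclideanSpace ℝ ι) : Measurable fun u => errorVec u h := by
  have : Measurable fun u => optSign u h :=
    Measurable.ite (measurableSet_le measurable_const (by fun_prop)) measurable_const
      measurable_const
  exact (this.smul measurable_id).sub_const h

theorem measurable_errorMu (h : EuclideanSpace ℝ ι) : Measurable fun u => errorMu u h := by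
  unfold errorMu
  exact (by fun_prop : Measurable fun y => inner ℝ h y).comp (measurable_errorVec h)

theorem measurable_errorQ (h : EuclideanSpace ℝ ι) : Measurable fun u => errorQ u h := by
  unfold errorQ
  exact (measurable_errorVec h).sub ((measurable_errorMu h).smul_const h)

end SignCorrection

variable [DecidableEq ι]

/-- The quadratic form of a symmetric matrix is bounded by its largest eigenvalue. -/
theorem inner_toEuclideanLin_le {A : Matrix ι ι ℝ} (hA : A.IsHermitian) {lam : ℝ}
    (hlam : lam ∈ upperBounds {x : ℝ | Module.End.HasEigenvalue (Matrix.toLin' A) x})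
    (x : EuclideanSpace ℝ ι) :
    inner ℝ x (Matrix.toEuclideanLin A x) ≤ lam * ‖x‖ ^ 2 := by
  have hs : (Matrix.toEuclideanLin A).IsSymmetric := Matrix.isSymmetric_toEuclideanLin_iff.2 hA
  have hle (i : ι) : hA.eigenvalues i ≤ lam := by
    refine hlam ?_
    refine Module.End.hasEigenvalue_of_hasEigenvector
      (x := (hA.eigenvectorBasis i).ofLp) ⟨?_, ?_⟩
    · rw [Module.End.mem_eigenspace_iff, Matrix.toLin'_apply]
      simpa using hA.mulVec_eigenvectorBasis i
    · have := hA.eigenvectorBasis.orthonormal.ne_zero i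
      intro h0
      exact this (by ext j; simp [h0])
  rw [← hA.eigenvectorBasis.sum_inner_mul_inner, ← hA.eigenvectorBasis.sum_sq_norm_inner_right x,
    Finset.mul_sum]
  refine Finset.sum_le_sum fun i _ => ?_
  have h1 : Matrix.toEuclideanLin A (hA.eigenvectorBasis i) =
      hA.eigenvalues i • hA.eigenvectorBasis i := by
    ext j
    have := congrFun (hA.mulVec_eigenvectorBasis i) j
    simpa using this
  rw [← hs, h1, real_inner_smul_left, real_inner_comm, Real.norm_eq_abs, sq_abs]
  nlinarith [hle i, mul_le_mul_of_nonneg_right (hle i)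
    (sq_nonneg (inner ℝ (hA.eigenvectorBasis i) x))]

/-- Cauchy–Schwarz in each row. The Frobenius norm serves as `δ` because its moments reduce to those
of single entries. -/
theorem norm_toEuclideanLin_le (B : Matrix ι ι ℝ) (x : EuclideanSpace ℝ ι) :
    ‖Matrix.toEuclideanLin B x‖ ≤ √(∑ k, ∑ l, B k l ^ 2) * ‖x‖ := by
  have h0 : 0 ≤ ∑ k, ∑ l, B k l ^ 2 :=
    Finset.sum_nonneg fun k _ => Finset.sum_nonneg fun l _ => sq_nonneg _
  refine le_of_sq_le_sq ?_ (by positivity)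
  rw [mul_pow, Real.sq_sqrt h0, EuclideanSpace.real_norm_sq_eq, EuclideanSpace.real_norm_sq_eq,
    Finset.sum_mul]
  refine Finset.sum_le_sum fun k _ => ?_
  have : (Matrix.toEuclideanLin B x) k = ∑ l, B k l * x l := by
    simp [Matrix.mulVec, dotProduct]
  rw [this]
  exact Finset.sum_mul_sq_le_sq_mul_sq _ _ _

/-- First-order perturbation bounds for the error of the leading eigenvector of
`g • h hᵀ + v • 1 + g • B`. -/
theorem errorQ_bounds {A B : Matrix ι ι ℝ} {h u : EuclideanSpace ℝ ι} {g v : ℝ} (hg : 0 < g)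
    (hh : ‖h‖ = 1) (hA : A.IsHermitian)
    (hAB : A = g • Matrix.vecMulVec h.ofLp h.ofLp + v • (1 : Matrix ι ι ℝ) + g • B)
    (hu : IsTopUnitEigenvector A u) :
    ‖errorQ u h‖ ^ 2 ≤ 16 * ∑ k, ∑ l, B k l ^ 2 ∧
    ‖errorQ u h - (Matrix.toEuclideanLin B h - inner ℝ h (Matrix.toEuclideanLin B h) • h)‖ ^ 2 ≤
      144 * (∑ k, ∑ l, B k l ^ 2) ^ 2 := by
  obtain ⟨hu1, lam, hlam, hev⟩ := hu
  have h0 : 0 ≤ ∑ k, ∑ l, B k l ^ 2 :=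
    Finset.sum_nonneg fun k _ => Finset.sum_nonneg fun l _ => sq_nonneg _
  have hAx (x : EuclideanSpace ℝ ι) : Matrix.toEuclideanLin A x =
      g • (inner ℝ h x • h + Matrix.toEuclideanLin B x) + v • x := by
    ext j
    simp only [hAB, Matrix.toLpLin_apply, Matrix.add_mulVec, Matrix.smul_mulVec, Matrix.one_mulVec,
      Matrix.vecMulVec_mulVec, PiLp.add_apply, PiLp.smul_apply, Pi.add_apply, Pi.smul_apply,
      smul_eq_mul, EuclideanSpace.inner_eq_star_dotProduct, dotProduct_comm x.ofLp,
      MulOpposite.smul_eq_mul_unop, MulOpposite.unop_op, star_trivial]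
    ring
  set e := optSign u h • u with he
  have hAe : Matrix.toEuclideanLin A e = lam • e := by
    have h1 : Matrix.toEuclideanLin A u = lam • u := by
      ext j
      have := congrFun hev.apply_eq_smul j
      simpa using this
    rw [he, map_smul, h1, smul_comm]
  have hκ := inner_toEuclideanLin_le hA hlam.2 h
  -- Subtracting `v • 1` and dividing by `g` changes no eigenvector and turns the top eigenvalue
  -- `lam` into `κ = (lam - v) / g`.
  have key := perturbed_eigenvector_bounds (e := e) hh (by rw [he, norm_optSign_smul, hu1])
    (Matrix.toEuclideanLin B) (Real.sqrt_nonneg _) (norm_toEuclideanLin_le B)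
    (κ := (lam - v) / g) (inner_optSign_smul_nonneg u h) ?_ ?_
  · rw [errorQ_eq hh]
    obtain ⟨k1, k2⟩ := key
    refine ⟨(pow_le_pow_left₀ (norm_nonneg _) k1 2).trans (le_of_eq ?_),
      (pow_le_pow_left₀ (norm_nonneg _) k2 2).trans (le_of_eq ?_)⟩
    · rw [mul_pow, Real.sq_sqrt h0]; norm_num
    · rw [mul_pow, Real.sq_sqrt h0]; norm_num
  · have h2 := hAx e
    rw [hAe] at h2
    have h3 : g • (inner ℝ h e • h + Matrix.toEuclideanLin B e) = (lam - v) • e := by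
      rw [sub_smul, h2]; abel
    rw [div_eq_inv_mul, mul_smul, ← h3, smul_smul, inv_mul_cancel₀ hg.ne', one_smul]
  · rw [hAx, inner_add_right, real_inner_smul_right, inner_add_right, real_inner_smul_right,
      real_inner_smul_right, real_inner_self_eq_norm_sq, hh] at hκ
    rw [le_div_iff₀ hg]
    linarith

end Perturbation

/-! ### Moments of the sample covariance error. -/

section SampleError

variable {ι : Type*} {Ω : Type*}

/-- The error of the empirical second-moment matrix of the vectors `γ h + m i`, `i < N`, where the
`m i` have covariance matrix `v • 1`. -/
noncomputable def sampleError [DecidableEq ι] (γ v : ℝ) (h : EuclideanSpace ℝ ι) (m : ℕ → Ω → EuclideanSpace ℝ ι) (N : ℕ)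
    (ω : Ω) : Matrix ι ι ℝ :=
  Matrix.of fun k l => (1 / (N : ℝ)) * ∑ i ∈ Finset.range N,
    ((γ * h k + m i ω k) * (γ * h l + m i ω l)) -
      (γ ^ 2 * (h k * h l) + v * (1 : Matrix ι ι ℝ) k l)

/-- A bound for the normalized fourth moments of the entries of a single-sample error. -/
noncomputable def entryMomentBound : ℝ :=
  64 * (2 * (∫ x, x ^ 4 ∂gaussianReal 0 1) + (∫ x, x ^ 8 ∂gaussianReal 0 1) + 1)

theorem entryMomentBound_pos : 0 < entryMomentBound := by
  unfold entryMomentBound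
  have h4 : 0 ≤ ∫ x, x ^ 4 ∂gaussianReal 0 1 := integral_nonneg fun x => by positivity
  have h8 : 0 ≤ ∫ x, x ^ 8 ∂gaussianReal 0 1 := integral_nonneg fun x => by positivity
  linarith

variable {γ v : ℝ} {h : EuclideanSpace ℝ ι} {m : ℕ → Ω → EuclideanSpace ℝ ι} {N : ℕ}

theorem sampleError_isHermitian [DecidableEq ι] (ω : Ω) : (sampleError γ v h m N ω).IsHermitian := by
  ext k l
  simp only [sampleError, Matrix.conjTranspose_apply, Matrix.of_apply, star_trivial]
  rw [mul_comm (h k), ← Matrix.transpose_apply (1 : Matrix ι ι ℝ) k l, Matrix.transpose_one]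
  simp only [mul_comm (γ * h l + _)]

variable [Fintype ι]

theorem abs_apply_le_one (hh : ‖h‖ = 1) (k : ι) : |h k| ≤ 1 := by
  have := PiLp.norm_apply_le h k
  rwa [hh, Real.norm_eq_abs] at this

theorem sum_mul_self_eq_one (hh : ‖h‖ = 1) : ∑ k, h k * h k = 1 := by
  have := EuclideanSpace.real_norm_sq_eq h
  rw [hh, one_pow] at this
  rw [this]
  exact Finset.sum_congr rfl fun k _ => (sq _).symm

variable [DecidableEq ι]

/-- Applying the error to the unit vector `h` gives a centred average of the samples treated in
`covariance_signal`. -/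
theorem sampleError_mulVec (hh : ‖h‖ = 1) (ω : Ω) (k : ι) :
    (sampleError γ v h m N ω).mulVec h.ofLp k =
      (1 / (N : ℝ)) * ∑ i ∈ Finset.range N, ((γ * h k + m i ω k) * (γ + inner ℝ h (m i ω))) -
        (γ ^ 2 + v) * h k := by
  have h1 (i : ℕ) : ∑ l, (γ * h l + m i ω l) * h l = γ + inner ℝ h (m i ω) := by
    simp only [add_mul, Finset.sum_add_distrib, mul_assoc, ← Finset.mul_sum,
      sum_mul_self_eq_one hh, mul_one]
    simp [PiLp.inner_apply]
  have h2 : ∑ l, (γ ^ 2 * (h k * h l) + v * (1 : Matrix ι ι ℝ) k l) * h l =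
      (γ ^ 2 + v) * h k := by
    have e : ∀ l, (γ ^ 2 * (h k * h l) + v * (1 : Matrix ι ι ℝ) k l) * h l =
      γ ^ 2 * h k * (h l * h l) + v * ((1 : Matrix ι ι ℝ) k l * h l) := fun l => by ring
    simp only [e, Finset.sum_add_distrib, ← Finset.mul_sum, sum_mul_self_eq_one hh]
    simp [Matrix.one_apply]
    ring
  simp only [sampleError, Matrix.mulVec, dotProduct, Matrix.of_apply, sub_mul,
    Finset.sum_sub_distrib, h2]
  congr 1
  simp only [mul_assoc, ← Finset.mul_sum, Finset.sum_mul]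
  rw [Finset.sum_comm]
  simp only [← Finset.mul_sum, h1]

variable [MeasurableSpace Ω] {P : Measure Ω} [IsProbabilityMeasure P]

theorem hasAllMoments_sampleError (hm : ∀ i, IsIsotropicGaussian P v (m i)) (k l : ι) :
    HasAllMoments (fun ω => sampleError γ v h m N ω k l) P := by
  unfold sampleError
  exact ((HasAllMoments.sum _ fun i _ =>
    ((HasAllMoments.const _).add ((hm i).hasAllMoments_apply k)).mul
      ((HasAllMoments.const _).add ((hm i).hasAllMoments_apply l))).const_mul _).sub
      (HasAllMoments.const _)

theorem hasAllMoments_sampleError_mulVec (hm : ∀ i, IsIsotropicGaussian P v (m i)) (k : ι) :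
    HasAllMoments (fun ω => (sampleError γ v h m N ω).mulVec h.ofLp k) P := by
  unfold Matrix.mulVec dotProduct
  exact HasAllMoments.sum _ fun l _ => (hasAllMoments_sampleError hm k l).mul
    (HasAllMoments.const _)

theorem integral_signal {X : Ω → EuclideanSpace ℝ ι}
    (hX : IsIsotropicGaussian P v X) (k : ι) :
    ∫ ω, (γ * h k + X ω k) * (γ + inner ℝ h (X ω)) ∂P = (γ ^ 2 + v) * h k := by
  have e : ∀ ω, (γ * h k + X ω k) * (γ + inner ℝ h (X ω)) =
      (γ ^ 2 * h k + γ * X ω k) + (γ * h k * inner ℝ h (X ω) + X ω k * inner ℝ h (X ω)) :=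
    fun ω => by ring
  have j1 := HasAllMoments.const (P := P) (γ ^ 2 * h k)
  have j2 := (hX.hasAllMoments_apply k).const_mul γ
  have j3 := (hX.hasAllMoments_inner h).const_mul (γ * h k)
  have j4 := (hX.hasAllMoments_apply k).mul (hX.hasAllMoments_inner h)
  have xk : ∫ ω, X ω k * inner ℝ h (X ω) ∂P = v * h k := by
    have := hX.integral_inner_mul_inner (EuclideanSpace.single k 1) h
    simpa only [IsIsotropicGaussian.inner_single] using this
  simp only [e]
  rw [integral_add (j1.add j2).integrable (j3.add j4).integrable,
    integral_add j1.integrable j2.integrable, integral_add j3.integrable j4.integrable,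
    integral_const, integral_const_mul, integral_const_mul,
    hX.integral_apply, hX.integral_inner, xk]
  simp
  ring

theorem integral_signal_mul_signal {X : Ω → EuclideanSpace ℝ ι}
    (hX : IsIsotropicGaussian P v X) (k l : ι) :
    ∫ ω, (γ * h k + X ω k) * (γ * h l + X ω l) ∂P =
      γ ^ 2 * (h k * h l) + v * (1 : Matrix ι ι ℝ) k l := by
  have e : ∀ ω, (γ * h k + X ω k) * (γ * h l + X ω l) =
      (γ ^ 2 * (h k * h l) + γ * h l * X ω k) + (γ * h k * X ω l + X ω k * X ω l) :=
    fun ω => by ring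
  have j1 := HasAllMoments.const (P := P) (γ ^ 2 * (h k * h l))
  have j2 := (hX.hasAllMoments_apply k).const_mul (γ * h l)
  have j3 := (hX.hasAllMoments_apply l).const_mul (γ * h k)
  have j4 := (hX.hasAllMoments_apply k).mul (hX.hasAllMoments_apply l)
  simp only [e]
  rw [integral_add (j1.add j2).integrable (j3.add j4).integrable,
    integral_add j1.integrable j2.integrable, integral_add j3.integrable j4.integrable,
    integral_const, integral_const_mul, integral_const_mul,
    hX.integral_apply, hX.integral_apply,
    hX.integral_apply_mul_apply]
  simp

/-- The exact second-order moments of the error of the empirical second-moment matrix, applied to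
the signal direction. -/
theorem integral_sampleError_mulVec_mul (hm : ∀ i, IsIsotropicGaussian P v (m i))
    (hind : iIndepFun m P) (hh : ‖h‖ = 1) (hN : 1 ≤ N) (k l : ι) :
    ∫ ω, (sampleError γ v h m N ω).mulVec h.ofLp k * (sampleError γ v h m N ω).mulVec h.ofLp l ∂P =
      (1 / (N : ℝ)) * ((3 * γ ^ 2 * v + v ^ 2) * (h k * h l) +
        (γ ^ 2 * v + v ^ 2) * (1 : Matrix ι ι ℝ) k l) := by
  have hN0 : (N : ℝ) ≠ 0 := by positivity
  set Y : ι → ℕ → Ω → ℝ := fun k i ω => (γ * h k + m i ω k) * (γ + inner ℝ h (m i ω)) with hY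
  have mY (k : ι) (i : ℕ) : HasAllMoments (Y k i) P :=
    ((HasAllMoments.const _).add ((hm i).hasAllMoments_apply k)).mul
      ((HasAllMoments.const _).add ((hm i).hasAllMoments_inner h))
  have mean (k : ι) : ∫ ω, (1 / (N : ℝ)) * ∑ i ∈ Finset.range N, Y k i ω ∂P =
      (γ ^ 2 + v) * h k := by
    rw [integral_const_mul, integral_finsetSum _ fun i _ => (mY k i).integrable]
    simp only [hY, integral_signal (hm _), Finset.sum_const, Finset.card_range, nsmul_eq_mul]
    field_simp
  have hcov := covariance_sum_of_indep mY k l (fun i j hij => by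
    have hf (k : ι) : Measurable fun y : EuclideanSpace ℝ ι =>
      (γ * h k + y k) * (γ + inner ℝ h y) := by fun_prop
    exact (hind.indepFun hij).comp (hf k) (hf l))
    (fun i => (hm i).covariance_signal h hh γ k l) N
  simp only [sampleError_mulVec hh]
  -- By `mean` the subtracted constants are the expectations, so the mixed second moment is a
  -- covariance.
  calc _ = cov[fun ω => (1 / (N : ℝ)) * ∑ i ∈ Finset.range N, Y k i ω,
        fun ω => (1 / (N : ℝ)) * ∑ i ∈ Finset.range N, Y l i ω; P] := by
        simp only [covariance, mean]
        rfl
    _ = _ := by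
        rw [covariance_const_mul_left, covariance_const_mul_right, hcov]
        field_simp

/-- After the signal term `γ² h_k h_l` cancels, the fourth moments are of order `γ⁴ v²` or `v⁴`, and
both are at most `(γ² v + v²)²`. That quantity is the square of the one in `leadingOrder`, which is
what makes the final estimate uniform in the signal-to-noise ratio. -/
theorem integral_entry_pow_four_le (hh : ‖h‖ = 1) {X : Ω → EuclideanSpace ℝ ι}
    (hX : IsIsotropicGaussian P v X) (k l : ι) :
    ∫ ω, ((γ * h k + X ω k) * (γ * h l + X ω l) -
      (γ ^ 2 * (h k * h l) + v * (1 : Matrix ι ι ℝ) k l)) ^ 4 ∂P ≤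
      entryMomentBound * (γ ^ 2 * v + v ^ 2) ^ 2 := by
  have hv := hX.nonneg
  -- The constant is `8 · 8`, from using `(x + y)⁴ ≤ 8 (x⁴ + y⁴)` twice.
  have quad (a b c d : ℝ) : (a + b + c + d) ^ 4 ≤ 64 * (a ^ 4 + b ^ 4 + c ^ 4 + d ^ 4) := by
    have h2 (x y : ℝ) : (x + y) ^ 4 ≤ 8 * (x ^ 4 + y ^ 4) := (Even.add_pow_le (by decide)).trans_eq (by norm_num)
    have := h2 (a + b) (c + d)
    have := h2 a b
    have := h2 c d
    have : (a + b + c + d) ^ 4 = (a + b + (c + d)) ^ 4 := by ring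
    linarith
  have hsmall (t y : ℝ) (ht : |t| ≤ 1) : (γ * t * y) ^ 4 ≤ γ ^ 4 * y ^ 4 := by
    have h1 : t ^ 4 ≤ 1 := by
      have := pow_le_one₀ (abs_nonneg t) ht (n := 4)
      rwa [Even.pow_abs (by decide)] at this
    calc (γ * t * y) ^ 4 = t ^ 4 * (γ ^ 4 * y ^ 4) := by ring
      _ ≤ 1 * (γ ^ 4 * y ^ 4) := mul_le_mul_of_nonneg_right h1 (by positivity)
      _ = _ := one_mul _
  have hδ : (-(v * (1 : Matrix ι ι ℝ) k l)) ^ 4 ≤ v ^ 4 := by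
    rw [Matrix.one_apply]
    split_ifs <;> simp
    · exact le_of_eq (by ring)
    · positivity
  have hpt (ω : Ω) : ((γ * h k + X ω k) * (γ * h l + X ω l) -
      (γ ^ 2 * (h k * h l) + v * (1 : Matrix ι ι ℝ) k l)) ^ 4 ≤
      64 * ((γ ^ 4 * X ω l ^ 4 + γ ^ 4 * X ω k ^ 4) +
        ((1 / 2 * X ω k ^ 8 + 1 / 2 * X ω l ^ 8) + v ^ 4)) := by
    have e : (γ * h k + X ω k) * (γ * h l + X ω l) -
      (γ ^ 2 * (h k * h l) + v * (1 : Matrix ι ι ℝ) k l) =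
      γ * h k * X ω l + γ * h l * X ω k + X ω k * X ω l + -(v * (1 : Matrix ι ι ℝ) k l) := by ring
    have h1 := hsmall _ (X ω l) (abs_apply_le_one hh k)
    have h2 := hsmall _ (X ω k) (abs_apply_le_one hh l)
    have h3 : (X ω k * X ω l) ^ 4 ≤ 1 / 2 * X ω k ^ 8 + 1 / 2 * X ω l ^ 8 := by
      nlinarith [sq_nonneg (X ω k ^ 4 - X ω l ^ 4)]
    rw [e]
    have := quad (γ * h k * X ω l) (γ * h l * X ω k) (X ω k * X ω l)
      (-(v * (1 : Matrix ι ι ℝ) k l))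
    linarith
  have j1 := ((hX.hasAllMoments_apply l).pow 4).const_mul (γ ^ 4)
  have j2 := ((hX.hasAllMoments_apply k).pow 4).const_mul (γ ^ 4)
  have j3 := ((hX.hasAllMoments_apply k).pow 8).const_mul (1 / 2)
  have j4 := ((hX.hasAllMoments_apply l).pow 8).const_mul (1 / 2)
  have j5 := HasAllMoments.const (P := P) (v ^ 4)
  have s4 : √v ^ 4 = v ^ 2 := by
    rw [show √v ^ 4 = (√v ^ 2) ^ 2 by ring, Real.sq_sqrt hv]
  have s8 : √v ^ 8 = v ^ 4 := by
    rw [show √v ^ 8 = (√v ^ 2) ^ 4 by ring, Real.sq_sqrt hv]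
  refine (integral_mono_of_nonneg (Eventually.of_forall fun ω => by positivity)
    (((j1.add j2).add ((j3.add j4).add j5)).const_mul 64).integrable
    (Eventually.of_forall hpt)).trans ?_
  rw [integral_const_mul, integral_add (j1.add j2).integrable ((j3.add j4).add j5).integrable,
    integral_add j1.integrable j2.integrable, integral_add (j3.add j4).integrable j5.integrable,
    integral_add j3.integrable j4.integrable, integral_const_mul, integral_const_mul,
    integral_const_mul, integral_const_mul, hX.integral_apply_pow, hX.integral_apply_pow,
    hX.integral_apply_pow, hX.integral_apply_pow, s4, s8]
  have h4 : 0 ≤ ∫ x, x ^ 4 ∂gaussianReal 0 1 := integral_nonneg fun x => by positivity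
  have h8 : 0 ≤ ∫ x, x ^ 8 ∂gaussianReal 0 1 := integral_nonneg fun x => by positivity
  simp only [integral_const, probReal_univ, smul_eq_mul, one_mul, entryMomentBound]
  set a := ∫ x, x ^ 4 ∂gaussianReal 0 1
  set c := ∫ x, x ^ 8 ∂gaussianReal 0 1
  have e : (γ ^ 2 * v + v ^ 2) ^ 2 = γ ^ 4 * v ^ 2 + v ^ 4 + 2 * (γ ^ 2 * v ^ 3) := by ring
  have n1 : 0 ≤ γ ^ 4 * v ^ 2 := by positivity
  have n2 : 0 ≤ v ^ 4 := by positivity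
  have n3 : 0 ≤ γ ^ 2 * v ^ 3 := by positivity
  have hA : γ ^ 4 * v ^ 2 ≤ (γ ^ 2 * v + v ^ 2) ^ 2 := by linarith
  have hB : v ^ 4 ≤ (γ ^ 2 * v + v ^ 2) ^ 2 := by linarith
  have := mul_le_mul_of_nonneg_left hA h4
  have := mul_le_mul_of_nonneg_left hB h8
  nlinarith

theorem integral_sampleError_pow_four_le (hm : ∀ i, IsIsotropicGaussian P v (m i))
    (hind : iIndepFun m P) (hh : ‖h‖ = 1) (hN : 1 ≤ N) (k l : ι) :
    ∫ ω, sampleError γ v h m N ω k l ^ 4 ∂P ≤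
      3 * entryMomentBound * ((γ ^ 2 * v + v ^ 2) / N) ^ 2 := by
  have hN0 : (N : ℝ) ≠ 0 := by positivity
  set c := γ ^ 2 * (h k * h l) + v * (1 : Matrix ι ι ℝ) k l with hc
  set f : EuclideanSpace ℝ ι → ℝ := fun y => (γ * h k + y k) * (γ * h l + y l) - c with hf
  have mf : Measurable f := by fun_prop
  have mX (i : ℕ) : HasAllMoments (fun ω => (γ * h k + m i ω k) * (γ * h l + m i ω l)) P :=
    ((HasAllMoments.const _).add ((hm i).hasAllMoments_apply k)).mul
      ((HasAllMoments.const _).add ((hm i).hasAllMoments_apply l))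
  have key := integral_sum_pow_four_le (X := fun i ω => f (m i ω)) (P := P)
    (fun i => (mX i).sub (HasAllMoments.const c)) (fun i => mf.comp (hm i).measurable)
    (hind.comp (fun _ => f) fun _ => mf)
    (fun i => by
      simp only [hf]
      rw [integral_sub (mX i).integrable (integrable_const c), integral_signal_mul_signal (hm i)]
      simp [hc])
    (fun i => integral_entry_pow_four_le hh (hm i) k l) N
  have e (ω : Ω) : sampleError γ v h m N ω k l ^ 4 =
      (1 / (N : ℝ)) ^ 4 * (∑ i ∈ Finset.range N, f (m i ω)) ^ 4 := by
    rw [← mul_pow]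
    congr 1
    simp only [sampleError, Matrix.of_apply, hf, Finset.sum_sub_distrib, Finset.sum_const,
      Finset.card_range, nsmul_eq_mul]
    rw [← hc]
    field_simp
  simp only [e]
  rw [integral_const_mul]
  refine (mul_le_mul_of_nonneg_left key (by positivity)).trans (le_of_eq ?_)
  field_simp

end SampleError

/-! ### From the deterministic bounds to the mean-squared error. -/

section MeanSquaredError

theorem sum_sum_sq_sq_le {ι : Type*} [Fintype ι] (B : Matrix ι ι ℝ) :
    (∑ k, ∑ l, B k l ^ 2) ^ 2 ≤ (Fintype.card ι : ℝ) ^ 2 * ∑ k, ∑ l, B k l ^ 4 := by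
  rw [← Fintype.sum_prod_type' (f := fun k l => B k l ^ 2),
    ← Fintype.sum_prod_type' (f := fun k l => B k l ^ 4)]
  have := sq_sum_le_card_mul_sum_sq (s := (Finset.univ : Finset (ι × ι)))
    (f := fun p => B p.1 p.2 ^ 2)
  rw [Finset.card_univ, Fintype.card_prod] at this
  push_cast at this
  refine this.trans (le_of_eq ?_)
  rw [sq (Fintype.card ι : ℝ)]
  congr 1
  exact Finset.sum_congr rfl fun p _ => by ring

variable {ι : Type*} [Fintype ι] [DecidableEq ι] {Ω : Type*} [MeasurableSpace Ω]
  {P : Measure Ω} [IsProbabilityMeasure P] {γ v : ℝ} {h : EuclideanSpace ℝ ι}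
  {m : ℕ → Ω → EuclideanSpace ℝ ι} {N : ℕ}

/-- The leading order of the mean-squared orthogonal error. -/
noncomputable def leadingOrder (ι : Type*) [Fintype ι] (γ v : ℝ) (N : ℕ) : ℝ :=
  (γ ^ 2 * v + v ^ 2) / N / γ ^ 4 * ((Fintype.card ι : ℝ) - 1)

/-- The constant in the bound of the mean fourth power of the normalized covariance error. -/
noncomputable def errorConst (ι : Type*) [Fintype ι] : ℝ :=
  3 * (Fintype.card ι : ℝ) ^ 4 * entryMomentBound

theorem hasAllMoments_sum_sq (hm : ∀ i, IsIsotropicGaussian P v (m i)) (c : ℝ) :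
    HasAllMoments (fun ω => ∑ k, ∑ l, (c • sampleError γ v h m N ω) k l ^ 2) P :=
  HasAllMoments.sum _ fun k _ => HasAllMoments.sum _ fun l _ =>
    ((hasAllMoments_sampleError hm k l).const_mul c).pow 2

theorem integral_sum_sq_sq_le (hm : ∀ i, IsIsotropicGaussian P v (m i)) (hind : iIndepFun m P)
    (hh : ‖h‖ = 1) (hγ : 0 < γ) (hN : 1 ≤ N) (hcard : 2 ≤ Fintype.card ι) :
    ∫ ω, (∑ k, ∑ l, ((γ ^ 2)⁻¹ • sampleError γ v h m N ω) k l ^ 2) ^ 2 ∂P ≤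
      errorConst ι * leadingOrder ι γ v N ^ 2 := by
  have hv := (hm 0).nonneg
  have hK := entryMomentBound_pos
  have hm4 (k l : ι) : HasAllMoments (fun ω => ((γ ^ 2)⁻¹ • sampleError γ v h m N ω) k l ^ 4) P :=
    ((hasAllMoments_sampleError hm k l).const_mul _).pow 4
  refine (integral_mono_of_nonneg (Eventually.of_forall fun ω => by positivity)
    ((HasAllMoments.sum Finset.univ fun k _ => HasAllMoments.sum Finset.univ fun l _ =>
      hm4 k l).const_mul _).integrable
    (Eventually.of_forall fun ω => sum_sum_sq_sq_le _)).trans ?_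
  rw [integral_const_mul, integral_finsetSum _ fun k _ =>
    (HasAllMoments.sum Finset.univ fun l _ => hm4 k l).integrable]
  have hle (k l : ι) : ∫ ω, ((γ ^ 2)⁻¹ • sampleError γ v h m N ω) k l ^ 4 ∂P ≤
      3 * entryMomentBound * ((γ ^ 2 * v + v ^ 2) / N / γ ^ 4) ^ 2 := by
    simp only [Matrix.smul_apply, smul_eq_mul, mul_pow]
    rw [integral_const_mul]
    refine (mul_le_mul_of_nonneg_left (integral_sampleError_pow_four_le hm hind hh hN k l)
      (by positivity)).trans (le_of_eq ?_)
    field_simp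
  have hsum : ∑ k, ∫ ω, ∑ l, ((γ ^ 2)⁻¹ • sampleError γ v h m N ω) k l ^ 4 ∂P ≤
      (Fintype.card ι : ℝ) ^ 2 * (3 * entryMomentBound *
        ((γ ^ 2 * v + v ^ 2) / N / γ ^ 4) ^ 2) := by
    have : ∀ k ∈ Finset.univ, ∫ ω, ∑ l, ((γ ^ 2)⁻¹ • sampleError γ v h m N ω) k l ^ 4 ∂P ≤
        (Fintype.card ι : ℝ) * (3 * entryMomentBound *
          ((γ ^ 2 * v + v ^ 2) / N / γ ^ 4) ^ 2) := fun k _ => by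
      rw [integral_finsetSum _ fun l _ => (hm4 k l).integrable]
      refine (Finset.sum_le_sum fun l _ => hle k l).trans (le_of_eq ?_)
      simp
    refine (Finset.sum_le_sum this).trans (le_of_eq ?_)
    simp
    ring
  refine (mul_le_mul_of_nonneg_left hsum (by positivity)).trans ?_
  -- Dimension at least two allows inserting the factor `card - 1`, so the bound is expressed
  -- through `leadingOrder` itself.
  have hd : (1 : ℝ) ≤ (Fintype.card ι : ℝ) - 1 := by
    have : (2 : ℝ) ≤ Fintype.card ι := by exact_mod_cast hcard
    linarith
  unfold errorConst leadingOrder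
  set t := (γ ^ 2 * v + v ^ 2) / N / γ ^ 4
  have ht : 0 ≤ t := by positivity
  have : t ^ 2 ≤ (t * ((Fintype.card ι : ℝ) - 1)) ^ 2 :=
    pow_le_pow_left₀ ht (le_mul_of_one_le_right ht hd) 2
  calc _ = 3 * (Fintype.card ι : ℝ) ^ 4 * entryMomentBound * t ^ 2 := by ring
    _ ≤ _ := mul_le_mul_of_nonneg_left this (by positivity)

/-- The first-order term of the orthogonal error. -/
noncomputable def firstOrder (B : Matrix ι ι ℝ) (h : EuclideanSpace ℝ ι) : EuclideanSpace ℝ ι :=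
  Matrix.toEuclideanLin B h - inner ℝ h (Matrix.toEuclideanLin B h) • h

/-- Pythagoras, with `⟨h, B h⟩²` expanded so that only products of entries of `B h`, whose means are
known exactly, occur. -/
theorem norm_firstOrder_sq (hh : ‖h‖ = 1) (B : Matrix ι ι ℝ) (c : ℝ) :
    ‖firstOrder (c • B) h‖ ^ 2 = c ^ 2 * (∑ k, B.mulVec h.ofLp k * B.mulVec h.ofLp k -
      ∑ k, ∑ l, h k * h l * (B.mulVec h.ofLp k * B.mulVec h.ofLp l)) := by
  have h1 : ‖Matrix.toEuclideanLin (c • B) h‖ ^ 2 =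
      c ^ 2 * ∑ k, B.mulVec h.ofLp k * B.mulVec h.ofLp k := by
    rw [EuclideanSpace.real_norm_sq_eq, Finset.mul_sum]
    refine Finset.sum_congr rfl fun k _ => ?_
    simp
    ring
  have h2 : inner ℝ h (Matrix.toEuclideanLin (c • B) h) =
      c * ∑ k, h k * B.mulVec h.ofLp k := by
    rw [PiLp.inner_apply, Finset.mul_sum]
    refine Finset.sum_congr rfl fun k _ => ?_
    simp
    ring
  rw [firstOrder, norm_sub_sq_real, norm_smul, real_inner_smul_right, hh, Real.norm_eq_abs,
    mul_one, sq_abs, real_inner_comm h _, h1, h2]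
  have h3 : (∑ k, h k * B.mulVec h.ofLp k) ^ 2 =
      ∑ k, ∑ l, h k * h l * (B.mulVec h.ofLp k * B.mulVec h.ofLp l) := by
    rw [sq, Finset.sum_mul_sum]
    exact Finset.sum_congr rfl fun k _ => Finset.sum_congr rfl fun l _ => by ring
  rw [← h3]
  ring

theorem hasAllMoments_norm_firstOrder_sq (hm : ∀ i, IsIsotropicGaussian P v (m i)) (hh : ‖h‖ = 1)
    (c : ℝ) : HasAllMoments (fun ω => ‖firstOrder (c • sampleError γ v h m N ω) h‖ ^ 2) P := by
  simp only [norm_firstOrder_sq hh]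
  have hB := hasAllMoments_sampleError_mulVec (N := N) (γ := γ) (h := h) hm
  exact ((HasAllMoments.sum _ fun k _ => (hB k).mul (hB k)).sub
    (HasAllMoments.sum _ fun k _ => HasAllMoments.sum _ fun l _ =>
      ((hB k).mul (hB l)).const_mul _)).const_mul _

/-- For a second-moment matrix `M = a h hᵀ + c I` the mean is `tr M - hᵀ M h = c (card - 1)`: the
part along `h hᵀ` drops out. -/
theorem integral_norm_firstOrder_sq (hm : ∀ i, IsIsotropicGaussian P v (m i))
    (hind : iIndepFun m P) (hh : ‖h‖ = 1) (hγ : 0 < γ) (hN : 1 ≤ N) :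
    ∫ ω, ‖firstOrder ((γ ^ 2)⁻¹ • sampleError γ v h m N ω) h‖ ^ 2 ∂P = leadingOrder ι γ v N := by
  have hB := hasAllMoments_sampleError_mulVec (N := N) (γ := γ) (h := h) hm
  have hsum := sum_mul_self_eq_one hh
  simp only [norm_firstOrder_sq hh]
  rw [integral_const_mul, integral_sub
    (HasAllMoments.sum Finset.univ fun k _ => (hB k).mul (hB k)).integrable
    (HasAllMoments.sum Finset.univ fun k _ => HasAllMoments.sum Finset.univ fun l _ =>
      ((hB k).mul (hB l)).const_mul _).integrable,
    integral_finsetSum _ fun k _ => ((hB k).mul (hB k)).integrable,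
    integral_finsetSum _ fun k _ => (HasAllMoments.sum Finset.univ fun l _ =>
      ((hB k).mul (hB l)).const_mul _).integrable]
  have e1 : ∑ k, ∫ ω, (sampleError γ v h m N ω).mulVec h.ofLp k *
      (sampleError γ v h m N ω).mulVec h.ofLp k ∂P =
      (1 / (N : ℝ)) * ((3 * γ ^ 2 * v + v ^ 2) + (γ ^ 2 * v + v ^ 2) * Fintype.card ι) := by
    simp only [integral_sampleError_mulVec_mul hm hind hh hN, Matrix.one_apply_eq, mul_one]
    rw [← Finset.mul_sum, Finset.sum_add_distrib, ← Finset.mul_sum, hsum]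
    simp only [Finset.sum_const, Finset.card_univ, nsmul_eq_mul]
    ring
  have e2 : ∑ k, ∫ ω, ∑ l, h k * h l * ((sampleError γ v h m N ω).mulVec h.ofLp k *
      (sampleError γ v h m N ω).mulVec h.ofLp l) ∂P =
      (1 / (N : ℝ)) * ((3 * γ ^ 2 * v + v ^ 2) + (γ ^ 2 * v + v ^ 2)) := by
    have e3 (k : ι) : ∫ ω, ∑ l, h k * h l * ((sampleError γ v h m N ω).mulVec h.ofLp k *
        (sampleError γ v h m N ω).mulVec h.ofLp l) ∂P =
        (1 / (N : ℝ)) * ((3 * γ ^ 2 * v + v ^ 2) + (γ ^ 2 * v + v ^ 2)) * (h k * h k) := by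
      rw [integral_finsetSum _ fun l _ => (((hB k).mul (hB l)).const_mul _).integrable]
      simp only [integral_const_mul, integral_sampleError_mulVec_mul hm hind hh hN]
      have e4 : ∀ l, h k * h l * (1 / (N : ℝ) * ((3 * γ ^ 2 * v + v ^ 2) * (h k * h l) +
          (γ ^ 2 * v + v ^ 2) * (1 : Matrix ι ι ℝ) k l)) =
          1 / (N : ℝ) * (3 * γ ^ 2 * v + v ^ 2) * (h k * h k) * (h l * h l) +
          1 / (N : ℝ) * (γ ^ 2 * v + v ^ 2) * h k * ((1 : Matrix ι ι ℝ) k l * h l) :=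
        fun l => by ring
      simp only [e4, Finset.sum_add_distrib]
      rw [← Finset.mul_sum, ← Finset.mul_sum, hsum]
      simp [Matrix.one_apply]
      ring
    simp only [e3]
    rw [← Finset.mul_sum, hsum, mul_one]
  rw [e1, e2, leadingOrder]
  have : (N : ℝ) ≠ 0 := by positivity
  field_simp
  ring

/-- Young's inequality for the cross term; the free `τ` is later taken to be a fraction of the
target accuracy. -/
theorem abs_norm_sq_sub_le {E : Type*} [NormedAddCommGroup E] [InnerProductSpace ℝ E] (q w : E)
    {τ : ℝ} (hτ : 0 < τ) :
    |‖q‖ ^ 2 - ‖w‖ ^ 2| ≤ τ * ‖w‖ ^ 2 + (1 + 1 / τ) * ‖q - w‖ ^ 2 := by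
  have h1 : ‖q‖ ^ 2 = ‖w‖ ^ 2 + 2 * inner ℝ w (q - w) + ‖q - w‖ ^ 2 := by
    rw [← norm_add_sq_real]; congr 2; abel
  have h2 := abs_real_inner_le_norm w (q - w)
  have h3 : 2 * (‖w‖ * ‖q - w‖) ≤ τ * ‖w‖ ^ 2 + 1 / τ * ‖q - w‖ ^ 2 := by
    have : 0 ≤ 1 / τ * (τ * ‖w‖ - ‖q - w‖) ^ 2 := by positivity
    have e : 1 / τ * (τ * ‖w‖ - ‖q - w‖) ^ 2 =
      τ * ‖w‖ ^ 2 + 1 / τ * ‖q - w‖ ^ 2 - 2 * (‖w‖ * ‖q - w‖) := by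
      field_simp
      ring
    linarith
  obtain ⟨h4, h5⟩ := abs_le.1 h2
  rw [abs_le]
  constructor <;> nlinarith [sq_nonneg ‖q - w‖]

/-- Mean bounds for the orthogonal error of the leading eigenvector. -/
theorem integral_errorQ_bounds (hm : ∀ i, IsIsotropicGaussian P v (m i)) (hind : iIndepFun m P)
    (hh : ‖h‖ = 1) (hγ : 0 < γ) (hN : 1 ≤ N) (hcard : 2 ≤ Fintype.card ι)
    {A : Ω → Matrix ι ι ℝ} (hA : ∀ᵐ ω ∂P, A ω = γ ^ 2 • Matrix.vecMulVec h.ofLp h.ofLp +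
      v • (1 : Matrix ι ι ℝ) + sampleError γ v h m N ω)
    {u : Ω → EuclideanSpace ℝ ι} (hum : AEMeasurable u P)
    (hu : ∀ᵐ ω ∂P, IsTopUnitEigenvector (A ω) (u ω)) :
    ∫ ω, ‖errorQ (u ω) h‖ ^ 4 ∂P ≤ 256 * errorConst ι * leadingOrder ι γ v N ^ 2 ∧
    ∀ τ, 0 < τ → |∫ ω, ‖errorQ (u ω) h‖ ^ 2 ∂P - leadingOrder ι γ v N| ≤
      τ * leadingOrder ι γ v N +
        (1 + 1 / τ) * (144 * (errorConst ι * leadingOrder ι γ v N ^ 2)) := by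
  set B : Ω → Matrix ι ι ℝ := fun ω => (γ ^ 2)⁻¹ • sampleError γ v h m N ω with hB
  have hT := integral_sum_sq_sq_le hm hind hh hγ hN hcard
  have mT : HasAllMoments (fun ω => (∑ k, ∑ l, B ω k l ^ 2) ^ 2) P :=
    (hasAllMoments_sum_sq hm _).pow 2
  have mW : HasAllMoments (fun ω => ‖firstOrder (B ω) h‖ ^ 2) P :=
    hasAllMoments_norm_firstOrder_sq hm hh _
  have hW : ∫ ω, ‖firstOrder (B ω) h‖ ^ 2 ∂P = leadingOrder ι γ v N :=
    integral_norm_firstOrder_sq hm hind hh hγ hN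
  have hpt : ∀ᵐ ω ∂P, ‖errorQ (u ω) h‖ ^ 2 ≤ 16 * ∑ k, ∑ l, B ω k l ^ 2 ∧
      ‖errorQ (u ω) h - firstOrder (B ω) h‖ ^ 2 ≤ 144 * (∑ k, ∑ l, B ω k l ^ 2) ^ 2 := by
    filter_upwards [hA, hu] with ω h1 h2
    refine errorQ_bounds (A := A ω) (v := v) (sq_pos_of_pos hγ) hh ?_ ?_ h2
    · rw [h1]
      refine Matrix.IsHermitian.add (Matrix.IsHermitian.add ?_ ?_) (sampleError_isHermitian ω)
      · ext k l
        simp [Matrix.vecMulVec_apply, mul_comm]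
      · exact Matrix.isHermitian_one.smul (IsSelfAdjoint.all v)
    · rw [h1, hB, smul_smul, mul_inv_cancel₀ (by positivity), one_smul]
  constructor
  · calc ∫ ω, ‖errorQ (u ω) h‖ ^ 4 ∂P ≤ ∫ ω, 256 * (∑ k, ∑ l, B ω k l ^ 2) ^ 2 ∂P := by
          refine integral_mono_of_nonneg (Eventually.of_forall fun ω => by positivity)
            (mT.const_mul _).integrable ?_
          filter_upwards [hpt] with ω ⟨h1, _⟩
          have := pow_le_pow_left₀ (sq_nonneg _) h1 2
          calc ‖errorQ (u ω) h‖ ^ 4 = (‖errorQ (u ω) h‖ ^ 2) ^ 2 := by ring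
            _ ≤ _ := this
            _ = _ := by ring
      _ ≤ _ := by
          rw [integral_const_mul, mul_assoc]
          exact mul_le_mul_of_nonneg_left hT (by norm_num)
  · intro τ hτ
    have mQ : Integrable (fun ω => ‖errorQ (u ω) h‖ ^ 2) P := by
      refine Integrable.of_bound (C := 1) ((((measurable_errorQ h).comp_aemeasurable hum).norm.pow_const
        2).aestronglyMeasurable) ?_
      filter_upwards [hu] with ω h2
      rw [Real.norm_eq_abs, abs_of_nonneg (sq_nonneg _)]
      exact pow_le_one₀ (norm_nonneg _) (norm_errorQ_le_one hh h2.1)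
    calc |∫ ω, ‖errorQ (u ω) h‖ ^ 2 ∂P - leadingOrder ι γ v N|
        = |∫ ω, (‖errorQ (u ω) h‖ ^ 2 - ‖firstOrder (B ω) h‖ ^ 2) ∂P| := by
          rw [integral_sub mQ mW.integrable, hW]
      _ ≤ ∫ ω, |‖errorQ (u ω) h‖ ^ 2 - ‖firstOrder (B ω) h‖ ^ 2| ∂P := abs_integral_le_integral_abs
      _ ≤ ∫ ω, (τ * ‖firstOrder (B ω) h‖ ^ 2 +
            (1 + 1 / τ) * (144 * (∑ k, ∑ l, B ω k l ^ 2) ^ 2)) ∂P := by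
          refine integral_mono_of_nonneg (Eventually.of_forall fun ω => abs_nonneg _)
            ((mW.const_mul _).add ((mT.const_mul _).const_mul _)).integrable ?_
          filter_upwards [hpt] with ω ⟨_, h2⟩
          refine (abs_norm_sq_sub_le _ _ hτ).trans ?_
          have : 0 ≤ 1 + 1 / τ := by positivity
          gcongr
      _ = τ * leadingOrder ι γ v N +
            (1 + 1 / τ) * (144 * ∫ ω, (∑ k, ∑ l, B ω k l ^ 2) ^ 2 ∂P) := by
          rw [integral_add (mW.const_mul _).integrable ((mT.const_mul _).const_mul _).integrable,
            integral_const_mul, integral_const_mul, integral_const_mul, hW]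
      _ ≤ _ := by
          have : 0 ≤ 1 + 1 / τ := by positivity
          gcongr

end MeanSquaredError

/-! ### The real representation of complex vectors. -/

section RealRepresentation

variable {J : ℕ}

theorem measurable_realRep : Measurable (realRep (J := J)) := by
  refine (WithLp.measurable_toLp 2 _).comp (measurable_pi_iff.2 ?_)
  rintro (k | k)
  · exact Complex.measurable_re.comp (by fun_prop)
  · exact Complex.measurable_im.comp (by fun_prop)

theorem realRep_smul_add (c : ℝ) (z w : EuclideanSpace ℂ (Fin J)) :
    realRep ((c : ℂ) • z + w) = c • realRep z + realRep w := by
  ext k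
  rcases k with k | k <;> simp [realRep]

theorem norm_realRep (z : EuclideanSpace ℂ (Fin J)) : ‖realRep z‖ = ‖z‖ := by
  rw [← sq_eq_sq₀ (norm_nonneg _) (norm_nonneg _), EuclideanSpace.real_norm_sq_eq,
    EuclideanSpace.norm_sq_eq, Fintype.sum_sum_type, ← Finset.sum_add_distrib]
  refine Finset.sum_congr rfl fun k _ => ?_
  rw [Complex.sq_norm, Complex.normSq_apply]
  simp [realRep]
  ring

theorem hbar_eq (g : EuclideanSpace ℂ (Fin J)) : hbar g = ‖g‖⁻¹ • realRep g := by
  have := realRep_smul_add ‖g‖⁻¹ g 0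
  have h0 : realRep (0 : EuclideanSpace ℂ (Fin J)) = 0 := by
    rw [← norm_eq_zero, norm_realRep, norm_zero]
  rw [add_zero, h0, add_zero] at this
  rw [hbar, normalizedChannel, ← this, Complex.ofReal_inv]

theorem norm_hbar {g : EuclideanSpace ℂ (Fin J)} (hg : g ≠ 0) : ‖hbar g‖ = 1 := by
  rw [hbar_eq, norm_smul, norm_realRep, norm_inv, norm_norm,
    inv_mul_cancel₀ (norm_ne_zero_iff.2 hg)]

theorem realRep_eq {g : EuclideanSpace ℂ (Fin J)} (hg : g ≠ 0) : realRep g = ‖g‖ • hbar g := by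
  rw [hbar_eq, smul_smul, mul_inv_cancel₀ (norm_ne_zero_iff.2 hg), one_smul]

end RealRepresentation

/-- The characteristic function is even. -/
theorem map_neg_multivariateGaussian {ι : Type*} [Fintype ι] [DecidableEq ι] {S : Matrix ι ι ℝ}
    (hS : S.PosSemidef) :
    (multivariateGaussian 0 S).map (fun x => -x) = multivariateGaussian 0 S := by
  have : IsFiniteMeasure ((multivariateGaussian 0 S).map (fun x => -x)) :=
    Measure.isFiniteMeasure_map _ _
  refine Measure.ext_of_charFun ?_
  funext t
  have h := charFun_map_smul (μ := multivariateGaussian 0 S) (-1) t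
  simp only [neg_smul, one_smul] at h
  rw [h, charFun_multivariateGaussian hS, charFun_multivariateGaussian hS]
  simp [Matrix.mulVec_neg]

/-! ### Reduction of the BPSK model to a constant signal, and the asymptotics. -/

section Model

variable {J : ℕ} {Ω : Type*} [MeasurableSpace Ω] {P : Measure Ω} [IsProbabilityMeasure P]
  {g : EuclideanSpace ℂ (Fin J)} {σ : ℝ} {b : ℕ → Ω → ℝ} {n : ℕ → Ω → EuclideanSpace ℂ (Fin J)}

/-- The noise after removal of the symbol, in the real representation. -/
def derotatedNoise (b : ℕ → Ω → ℝ) (n : ℕ → Ω → EuclideanSpace ℂ (Fin J)) (i : ℕ) (ω : Ω) :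
    EuclideanSpace ℝ (Fin J ⊕ Fin J) :=
  b i ω • realRep (n i ω)

namespace IsBPSKModel

/-- Two disjoint events of probability `1/2` exhaust the space up to a null set. -/
theorem symbol_eq (hM : IsBPSKModel P σ b n) : ∀ᵐ ω ∂P, ∀ i, b i ω = 1 ∨ b i ω = -1 := by
  rw [ae_all_iff]
  intro i
  have m1 : MeasurableSet {ω | b i ω = 1} := hM.measurable_symbol i (measurableSet_singleton 1)
  have m2 : MeasurableSet {ω | b i ω = -1} :=
    hM.measurable_symbol i (measurableSet_singleton (-1))
  have hd : Disjoint {ω | b i ω = 1} {ω | b i ω = -1} := by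
    rw [Set.disjoint_left]
    intro ω h1 h2
    simp only [Set.mem_ofPred_eq] at h1 h2
    rw [h1] at h2
    norm_num at h2
  have h1 : P ({ω | b i ω = 1} ∪ {ω | b i ω = -1}) = 1 := by
    rw [measure_union hd m2, hM.symbol_one, hM.symbol_neg_one, ENNReal.add_halves]
  exact (prob_compl_eq_zero_iff (m1.union m2)).2 h1

omit [IsProbabilityMeasure P] in
theorem measurable_derotatedNoise (hM : IsBPSKModel P σ b n) (i : ℕ) :
    Measurable (derotatedNoise b n i) :=
  (hM.measurable_symbol i).smul (measurable_realRep.comp (hM.measurable_noise i))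

theorem isIsotropicGaussian (hM : IsBPSKModel P σ b n) (i : ℕ) :
    IsIsotropicGaussian P (σ ^ 2 / 2) (derotatedNoise b n i) where
  nonneg := by positivity
  measurable := hM.measurable_derotatedNoise i
  map_eq := by
    set μ := multivariateGaussian 0
      ((σ ^ 2 / 2) • (1 : Matrix (Fin J ⊕ Fin J) (Fin J ⊕ Fin J) ℝ)) with hμ
    have hneg : μ.map (fun x => -x) = μ :=
      map_neg_multivariateGaussian (posSemidef_smul_one (by positivity))
    have mn : Measurable fun ω => realRep (n i ω) :=
      measurable_realRep.comp (hM.measurable_noise i)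
    have hind : IndepFun (b i) (fun ω => realRep (n i ω)) P :=
      (hM.indep_symbol_noise i).comp measurable_id measurable_realRep
    have hlaw : P.map (fun ω => realRep (n i ω)) = μ := hM.noise_law i
    ext A hA
    -- Splitting on `b = 1`: by independence each half contributes half the Gaussian mass of `A` or
    -- of `-A`, and these masses agree.
    rw [Measure.map_apply (hM.measurable_derotatedNoise i) hA,
      ← measure_inter_add_sdiff _ (hM.measurable_symbol i (measurableSet_singleton 1))]
    have e1 : derotatedNoise b n i ⁻¹' A ∩ b i ⁻¹' {1} =
        b i ⁻¹' {1} ∩ (fun ω => realRep (n i ω)) ⁻¹' A := by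
      ext ω
      simp only [derotatedNoise, Set.mem_inter_iff, Set.mem_preimage, Set.mem_singleton_iff]
      constructor
      · rintro ⟨h1, h2⟩
        rw [h2, one_smul] at h1
        exact ⟨h2, h1⟩
      · rintro ⟨h1, h2⟩
        rw [h1, one_smul]
        exact ⟨h2, rfl⟩
    have e2 : (derotatedNoise b n i ⁻¹' A \ b i ⁻¹' {1} : Set Ω) =ᵐ[P]
        (b i ⁻¹' {-1} ∩ (fun ω => realRep (n i ω)) ⁻¹' ((fun x => -x) ⁻¹' A) : Set Ω) := by
      filter_upwards [hM.symbol_eq] with ω hω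
      refine propext ?_
      change (derotatedNoise b n i ω ∈ A ∧ ¬ b i ω = 1) ↔ (b i ω = -1 ∧ -realRep (n i ω) ∈ A)
      unfold derotatedNoise
      rcases hω i with h | h
      · rw [h]; norm_num
      · rw [h]; norm_num
    have h1 : P (b i ⁻¹' {1}) = 1 / 2 := hM.symbol_one i
    have h2 : P (b i ⁻¹' {-1}) = 1 / 2 := hM.symbol_neg_one i
    have hA' : MeasurableSet ((fun x : EuclideanSpace ℝ (Fin J ⊕ Fin J) => -x) ⁻¹' A) :=
      measurable_neg hA
    rw [e1, measure_congr e2,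
      hind.measure_inter_preimage_eq_mul _ _ (measurableSet_singleton _) hA,
      hind.measure_inter_preimage_eq_mul _ _ (measurableSet_singleton _) hA', h1, h2,
      ← Measure.map_apply mn hA, ← Measure.map_apply mn hA', hlaw,
      ← Measure.map_apply measurable_neg hA, hneg, ← add_mul, ENNReal.add_halves, one_mul]

omit [IsProbabilityMeasure P] in
theorem iIndepFun_derotatedNoise (hM : IsBPSKModel P σ b n) :
    iIndepFun (derotatedNoise b n) P :=
  hM.indep_samples.comp (fun _ p => p.1 • realRep p.2) fun _ =>
    measurable_fst.smul (measurable_realRep.comp measurable_snd)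

/-- Almost surely `r̄ = b (γ h̄ + b n̄)`, and the sign squares away in products. -/
theorem rbar_mul_rbar (hM : IsBPSKModel P σ b n) (hg : g ≠ 0) : ∀ᵐ ω ∂P, ∀ i k l,
    rbar g b n i ω k * rbar g b n i ω l =
      (‖g‖ * hbar g k + derotatedNoise b n i ω k) * (‖g‖ * hbar g l + derotatedNoise b n i ω l) := by
  filter_upwards [hM.symbol_eq] with ω hω i k l
  have e (k) : rbar g b n i ω k = b i ω * (‖g‖ * hbar g k) + realRep (n i ω) k := by
    rw [rbar, received, realRep_smul_add, realRep_eq hg]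
    simp
  have e' (k) : derotatedNoise b n i ω k = b i ω * realRep (n i ω) k := by
    simp [derotatedNoise]
  rw [e, e, e', e']
  rcases hω i with h | h <;> rw [h] <;> ring

theorem covBar_apply (hM : IsBPSKModel P σ b n) (hg : g ≠ 0) (k l) :
    covBar P g b n k l = ‖g‖ ^ 2 * (hbar g k * hbar g l) +
      σ ^ 2 / 2 * (1 : Matrix (Fin J ⊕ Fin J) (Fin J ⊕ Fin J) ℝ) k l := by
  rw [← integral_signal_mul_signal (hM.isIsotropicGaussian 0) k l, covBar, Matrix.of_apply]
  refine integral_congr_ae ?_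
  filter_upwards [hM.rbar_mul_rbar hg] with ω hω
  exact hω 0 k l

theorem deltaCovBar_eq (hM : IsBPSKModel P σ b n) (hg : g ≠ 0) : ∀ᵐ ω ∂P, ∀ N,
    deltaCovBar P g b n N ω =
      sampleError ‖g‖ (σ ^ 2 / 2) (hbar g) (derotatedNoise b n) N ω := by
  filter_upwards [hM.rbar_mul_rbar hg] with ω hω N
  ext k l
  simp only [deltaCovBar, Matrix.sub_apply, hM.covBar_apply hg, sampleError, Matrix.of_apply,
    sampleCovBar, Matrix.smul_apply, Matrix.sum_apply, Matrix.vecMulVec_apply, hω, smul_eq_mul]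

theorem sampleCovBar_eq (hM : IsBPSKModel P σ b n) (hg : g ≠ 0) : ∀ᵐ ω ∂P, ∀ N,
    sampleCovBar g b n N ω = ‖g‖ ^ 2 • Matrix.vecMulVec (hbar g).ofLp (hbar g).ofLp +
      (σ ^ 2 / 2) • (1 : Matrix (Fin J ⊕ Fin J) (Fin J ⊕ Fin J) ℝ) +
      sampleError ‖g‖ (σ ^ 2 / 2) (hbar g) (derotatedNoise b n) N ω := by
  filter_upwards [hM.deltaCovBar_eq hg] with ω hω N
  rw [← hω, deltaCovBar]
  have : covBar P g b n = ‖g‖ ^ 2 • Matrix.vecMulVec (hbar g).ofLp (hbar g).ofLp +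
      (σ ^ 2 / 2) • (1 : Matrix (Fin J ⊕ Fin J) (Fin J ⊕ Fin J) ℝ) := by
    ext k l
    simp [hM.covBar_apply hg, Matrix.vecMulVec_apply]
  rw [← this, add_sub_cancel]

/-- By symmetry `δR̄ h̄ h̄ᵀ δR̄` is the outer product of `δR̄ h̄` with itself. -/
theorem deltaCovBar_mul_apply (hM : IsBPSKModel P σ b n) (hg : g ≠ 0) (N : ℕ) (k l) :
    (fun ω => (deltaCovBar P g b n N ω * Matrix.vecMulVec (hbar g).ofLp (hbar g).ofLp *
      deltaCovBar P g b n N ω) k l) =ᵐ[P] fun ω =>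
      (sampleError ‖g‖ (σ ^ 2 / 2) (hbar g) (derotatedNoise b n) N ω).mulVec (hbar g).ofLp k *
      (sampleError ‖g‖ (σ ^ 2 / 2) (hbar g) (derotatedNoise b n) N ω).mulVec (hbar g).ofLp l := by
  filter_upwards [hM.deltaCovBar_eq hg] with ω hω
  rw [hω]
  set B := sampleError ‖g‖ (σ ^ 2 / 2) (hbar g) (derotatedNoise b n) N ω with hB
  have hT : B.transpose = B := by
    have : B.IsHermitian := sampleError_isHermitian ω
    rwa [Matrix.IsHermitian, Matrix.conjTranspose_eq_transpose_of_trivial] at this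
  rw [Matrix.mul_vecMulVec, Matrix.vecMulVec_mul, Matrix.vecMulVec_apply, ← Matrix.mulVec_transpose,
    hT]

theorem leadingOrder_eq (g : EuclideanSpace ℂ (Fin J)) (σ : ℝ) (N : ℕ) :
    leadingOrder (Fin J ⊕ Fin J) ‖g‖ (σ ^ 2 / 2) N = mseFormula g σ N := by
  simp only [leadingOrder, mseFormula, Fintype.card_sum, Fintype.card_fin, Nat.cast_add]
  rw [div_div, div_eq_mul_one_div]
  ring

theorem integral_deltaCovBar (hM : IsBPSKModel P σ b n) (hg : g ≠ 0) {N : ℕ} (hN : 1 ≤ N) :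
    (∀ k l, Integrable (fun ω => (deltaCovBar P g b n N ω *
      Matrix.vecMulVec (hbar g).ofLp (hbar g).ofLp * deltaCovBar P g b n N ω) k l) P) ∧
    (Matrix.of fun k l => ∫ ω, (deltaCovBar P g b n N ω *
      Matrix.vecMulVec (hbar g).ofLp (hbar g).ofLp * deltaCovBar P g b n N ω) k l ∂P) =
    (1 / (N : ℝ)) •
      ((3 / 2 * σ ^ 2 * ‖g‖ ^ 2 + σ ^ 4 / 4) • Matrix.vecMulVec (hbar g).ofLp (hbar g).ofLp +
        (σ ^ 2 / 2 * ‖g‖ ^ 2 + σ ^ 4 / 4) •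
          (1 : Matrix (Fin J ⊕ Fin J) (Fin J ⊕ Fin J) ℝ)) := by
  have hB := hasAllMoments_sampleError_mulVec (N := N) (γ := ‖g‖) (h := hbar g)
    hM.isIsotropicGaussian
  constructor
  · intro k l
    exact ((hB k).mul (hB l)).integrable.congr (hM.deltaCovBar_mul_apply hg N k l).symm
  · ext k l
    rw [Matrix.of_apply, integral_congr_ae (hM.deltaCovBar_mul_apply hg N k l),
      integral_sampleError_mulVec_mul hM.isIsotropicGaussian hM.iIndepFun_derotatedNoise
        (norm_hbar hg) hN]
    simp only [Matrix.smul_apply, Matrix.add_apply, Matrix.vecMulVec_apply, smul_eq_mul]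
    ring

theorem one_le_of_ne_zero (hg : g ≠ 0) : 1 ≤ J := by
  rcases Nat.eq_zero_or_pos J with rfl | h
  · exact absurd (Subsingleton.elim g 0) hg
  · exact h

theorem mseFormula_pos (hg : g ≠ 0) (hσ : 0 < σ) {N : ℕ} (hN : 1 ≤ N) : 0 < mseFormula g σ N := by
  have h1 : 0 < ‖g‖ := norm_pos_iff.2 hg
  have h2 : (1 : ℝ) ≤ J := by exact_mod_cast one_le_of_ne_zero hg
  have h3 : 0 < 2 * (J : ℝ) - 1 := by linarith
  unfold mseFormula
  positivity

theorem integral_errorQ_bounds (hM : IsBPSKModel P σ b n) (hg : g ≠ 0) {N : ℕ} (hN : 1 ≤ N)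
    {u : Ω → EuclideanSpace ℝ (Fin J ⊕ Fin J)} (hum : AEMeasurable u P)
    (hu : ∀ᵐ ω ∂P, IsTopUnitEigenvector (sampleCovBar g b n N ω) (u ω)) :
    ∫ ω, ‖errorQ (u ω) (hbar g)‖ ^ 4 ∂P ≤
      256 * errorConst (Fin J ⊕ Fin J) * mseFormula g σ N ^ 2 ∧
    ∀ τ, 0 < τ → |∫ ω, ‖errorQ (u ω) (hbar g)‖ ^ 2 ∂P - mseFormula g σ N| ≤
      τ * mseFormula g σ N +
        (1 + 1 / τ) * (144 * (errorConst (Fin J ⊕ Fin J) * mseFormula g σ N ^ 2)) := by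
  rw [← leadingOrder_eq]
  refine SIMO.integral_errorQ_bounds hM.isIsotropicGaussian hM.iIndepFun_derotatedNoise
    (norm_hbar hg) (norm_pos_iff.2 hg) hN ?_ ?_ hum hu
  · have := one_le_of_ne_zero hg
    simp only [Fintype.card_sum, Fintype.card_fin]
    omega
  · filter_upwards [hM.sampleCovBar_eq hg] with ω hω
    exact hω N

end IsBPSKModel

/-- The uniform second-order approximation of the estimation error. -/
theorem exists_uniform_bound (J : ℕ) (ε : ℝ) (hε : 0 < ε) : ∃ η : ℝ, 0 < η ∧
    ∀ (Ω : Type*) [MeasurableSpace Ω] (P : Measure Ω) [IsProbabilityMeasure P]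
      (g : EuclideanSpace ℂ (Fin J)) (σ : ℝ) (b : ℕ → Ω → ℝ)
      (n : ℕ → Ω → EuclideanSpace ℂ (Fin J)) (N : ℕ)
      (u : Ω → EuclideanSpace ℝ (Fin J ⊕ Fin J)),
      g ≠ 0 → 0 < σ → IsBPSKModel P σ b n → 1 ≤ N → AEMeasurable u P →
      (∀ᵐ ω ∂P, IsTopUnitEigenvector (sampleCovBar g b n N ω) (u ω)) →
      mseFormula g σ N ≤ η →
      P.real {ω | ε * ‖errorQ (u ω) (hbar g)‖ ^ 2 < |errorMu (u ω) (hbar g)| ^ 2} ≤ ε ∧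
      ∫ ω, |errorMu (u ω) (hbar g)| ^ 2 ∂P ≤ ε * ∫ ω, ‖errorQ (u ω) (hbar g)‖ ^ 2 ∂P ∧
      |∫ ω, ‖errorVec (u ω) (hbar g)‖ ^ 2 ∂P - ∫ ω, ‖errorQ (u ω) (hbar g)‖ ^ 2 ∂P| ≤
        ε * ∫ ω, ‖errorQ (u ω) (hbar g)‖ ^ 2 ∂P ∧
      |∫ ω, ‖errorQ (u ω) (hbar g)‖ ^ 2 ∂P - mseFormula g σ N| ≤ ε * mseFormula g σ N := by
  set C := errorConst (Fin J ⊕ Fin J) with hC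
  have hC0 : 0 ≤ C := by
    have := entryMomentBound_pos
    rw [hC, errorConst]
    positivity
  -- The cap `1/2` yields `F/2 ≤ E‖q‖² ≤ 2F`, so that errors relative to `F` become errors relative
  -- to `E‖q‖²`.
  set δ := min ε (1 / 2) with hδ
  have hδ0 : 0 < δ := by rw [hδ]; positivity
  have hδε : δ ≤ ε := min_le_left _ _
  have hδ2 : δ ≤ 1 / 2 := min_le_right _ _
  -- With `τ = δ/2`, the condition `F K ≤ δ/2` absorbs the quadratic terms of both moment bounds;
  -- the summand `1` keeps `K` positive.
  set K := (1 + 1 / (δ / 2)) * (144 * C) + 256 * C + 1 with hK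
  have hK1 : 0 ≤ (1 + 1 / (δ / 2)) * (144 * C) := by positivity
  have hK0 : 0 < K := by linarith [mul_nonneg (by norm_num : (0 : ℝ) ≤ 256) hC0]
  -- The second bound on `F` serves Markov's inequality: `P(‖q‖² ≥ ε) ≤ E‖q‖²/ε ≤ 2F/ε ≤ ε`.
  refine ⟨min (δ / 2 / K) (ε ^ 2 / 2), by positivity, ?_⟩
  intro Ω _ P _ g σ b n N u hg hσ hM hN hum hu hF
  have hh := norm_hbar hg
  set F := mseFormula g σ N with hFdef
  have hF0 : 0 < F := IsBPSKModel.mseFormula_pos hg hσ hN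
  have hFK : F * K ≤ δ / 2 := (le_div_iff₀ hK0).1 (hF.trans (min_le_left _ _))
  have hFε : F ≤ ε ^ 2 / 2 := hF.trans (min_le_right _ _)
  obtain ⟨h4, h2⟩ := hM.integral_errorQ_bounds hg hN hum hu
  rw [← hFdef, ← hC] at h4 h2
  have hb2 := h2 (δ / 2) (by positivity)
  set I := ∫ ω, ‖errorQ (u ω) (hbar g)‖ ^ 2 ∂P with hI
  have hFF : F * (F * K) ≤ F * (δ / 2) := mul_le_mul_of_nonneg_left hFK hF0.le
  have hCF : 0 ≤ C * F ^ 2 := by positivity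
  have hKF : 0 ≤ (1 + 1 / (δ / 2)) * (144 * (C * F ^ 2)) := by positivity
  have hexp : F * (F * K) = (1 + 1 / (δ / 2)) * (144 * (C * F ^ 2)) + 256 * C * F ^ 2 + F ^ 2 := by
    rw [hK]; ring
  have hbI : |I - F| ≤ δ * F := by nlinarith [sq_nonneg F]
  have hb4 : ∫ ω, ‖errorQ (u ω) (hbar g)‖ ^ 4 ∂P ≤ δ / 2 * F := by nlinarith [sq_nonneg F]
  obtain ⟨hI1, hI2⟩ := abs_le.1 hbI
  have hIF : F / 2 ≤ I := by nlinarith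
  have hIF' : I ≤ 2 * F := by nlinarith
  have mQ : AEMeasurable (fun ω => ‖errorQ (u ω) (hbar g)‖) P :=
    ((measurable_errorQ _).comp_aemeasurable hum).norm
  have hQ1 : ∀ᵐ ω ∂P, ‖errorQ (u ω) (hbar g)‖ ≤ 1 := by
    filter_upwards [hu] with ω h using norm_errorQ_le_one hh h.1
  have iQ (k : ℕ) : Integrable (fun ω => ‖errorQ (u ω) (hbar g)‖ ^ k) P := by
    refine Integrable.of_bound (C := 1) (mQ.pow_const k).aestronglyMeasurable ?_
    filter_upwards [hQ1] with ω h
    rw [Real.norm_eq_abs, abs_of_nonneg (by positivity)]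
    exact pow_le_one₀ (norm_nonneg _) h
  have hμQ : ∀ᵐ ω ∂P, |errorMu (u ω) (hbar g)| ^ 2 ≤ ‖errorQ (u ω) (hbar g)‖ ^ 4 := by
    filter_upwards [hu] with ω h using abs_errorMu_sq_le hh h.1
  have mμ : AEMeasurable (fun ω => |errorMu (u ω) (hbar g)| ^ 2) P := by
    have := (((measurable_errorMu (hbar g)).comp_aemeasurable hum).norm).pow_const 2
    simpa only [Real.norm_eq_abs, Function.comp_apply] using this
  have iμ : Integrable (fun ω => |errorMu (u ω) (hbar g)| ^ 2) P := by
    refine (iQ 4).mono' mμ.aestronglyMeasurable ?_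
    filter_upwards [hμQ] with ω h
    rwa [Real.norm_eq_abs, abs_of_nonneg (by positivity)]
  have hEμ : ∫ ω, |errorMu (u ω) (hbar g)| ^ 2 ∂P ≤ ε * I := by
    have h1 := integral_mono_ae iμ (iQ 4) hμQ
    nlinarith
  refine ⟨?_, hEμ, ?_, hbI.trans (mul_le_mul_of_nonneg_right hδε hF0.le)⟩
  · have hsub : P.real {ω | ε * ‖errorQ (u ω) (hbar g)‖ ^ 2 < |errorMu (u ω) (hbar g)| ^ 2} ≤
        P.real {ω | ε ≤ ‖errorQ (u ω) (hbar g)‖ ^ 2} := by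
      refine ENNReal.toReal_mono (measure_ne_top _ _) (measure_mono_ae ?_)
      filter_upwards [hμQ] with ω h1 h2
      change ε * ‖errorQ (u ω) (hbar g)‖ ^ 2 < |errorMu (u ω) (hbar g)| ^ 2 at h2
      change ε ≤ ‖errorQ (u ω) (hbar g)‖ ^ 2
      by_contra h3
      push Not at h3
      nlinarith [sq_nonneg ‖errorQ (u ω) (hbar g)‖]
    have hmk := mul_meas_ge_le_integral_of_nonneg
      (Eventually.of_forall fun ω => sq_nonneg ‖errorQ (u ω) (hbar g)‖) (iQ 2) ε
    refine hsub.trans (le_of_mul_le_mul_left (hmk.trans ?_) hε)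
    rw [← hI]
    linarith [sq ε]
  · simp only [norm_errorVec_sq hh]
    rw [integral_add (iQ 2) iμ, ← hI, add_sub_cancel_left,
      abs_of_nonneg (integral_nonneg fun ω => by positivity)]
    exact hEμ

theorem tendsto_mseFormula (g : EuclideanSpace ℂ (Fin J)) (σ : ℝ) :
    Tendsto (fun N => mseFormula g σ N) atTop (nhds 0) := by
  have e (N : ℕ) : mseFormula g σ N = mseFormula g σ 1 / (N : ℝ) := by
    simp only [mseFormula, Nat.cast_one, one_mul, one_div, mul_inv]
    ring
  exact (tendsto_const_div_atTop_nhds_zero_nat _).congr fun N => (e N).symm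

omit [IsProbabilityMeasure P] in
/-- A sequence of random variables with summable fourth moments tends to zero almost surely. -/
theorem ae_tendsto_zero_of_summable {f : ℕ → Ω → ℝ} (hf : ∀ k, Integrable (fun ω => f k ω ^ 4) P)
    (hs : Summable fun k => ∫ ω, f k ω ^ 4 ∂P) :
    ∀ᵐ ω ∂P, Tendsto (fun k => f k ω ^ 4) atTop (nhds 0) := by
  have hl (k : ℕ) : ∫⁻ ω, ENNReal.ofReal (f k ω ^ 4) ∂P = ENNReal.ofReal (∫ ω, f k ω ^ 4 ∂P) :=
    (ofReal_integral_eq_lintegral_ofReal (hf k)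
      (Eventually.of_forall fun ω => by positivity)).symm
  have hm (k : ℕ) : AEMeasurable (fun ω => ENNReal.ofReal (f k ω ^ 4)) P :=
    (hf k).aestronglyMeasurable.aemeasurable.ennreal_ofReal
  -- By Tonelli the random series has finite mean; it therefore converges almost surely and its
  -- terms tend to zero.
  have hfin : ∫⁻ ω, ∑' k, ENNReal.ofReal (f k ω ^ 4) ∂P ≠ ⊤ := by
    rw [lintegral_tsum hm]
    simp only [hl]
    exact hs.tsum_ofReal_ne_top
  filter_upwards [ae_lt_top' (AEMeasurable.tsum hm) hfin] with ω hω
  have h1 := ENNReal.tendsto_atTop_zero_of_tsum_ne_top hω.ne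
  have h2 := (ENNReal.tendsto_toReal ENNReal.zero_ne_top).comp h1
  refine h2.congr fun k => ?_
  simp only [Function.comp_apply]
  exact ENNReal.toReal_ofReal (by positivity)

/-- The orthogonal error tends to zero almost surely. -/
theorem IsBPSKModel.ae_tendsto_errorQ (hM : IsBPSKModel P σ b n) (hg : g ≠ 0)
    {u : ℕ → Ω → EuclideanSpace ℝ (Fin J ⊕ Fin J)} (hum : ∀ N, AEMeasurable (u N) P)
    (hu : ∀ N, 1 ≤ N → ∀ᵐ ω ∂P, IsTopUnitEigenvector (sampleCovBar g b n N ω) (u N ω)) :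
    ∀ᵐ ω ∂P, Tendsto (fun N => ‖errorQ (u N ω) (hbar g)‖ ^ 4) atTop (nhds 0) := by
  have hh := norm_hbar hg
  -- The shift by one avoids `N = 0`, where nothing is assumed about `u`.
  have hi (k : ℕ) : Integrable (fun ω => ‖errorQ (u (k + 1) ω) (hbar g)‖ ^ 4) P := by
    refine Integrable.of_bound (C := 1) ((((measurable_errorQ (hbar g)).comp_aemeasurable
      (hum _)).norm.pow_const 4).aestronglyMeasurable) ?_
    filter_upwards [hu (k + 1) (by omega)] with ω h
    rw [Real.norm_eq_abs, abs_of_nonneg (by positivity)]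
    exact pow_le_one₀ (norm_nonneg _) (norm_errorQ_le_one hh h.1)
  have hs : Summable fun k : ℕ => ∫ ω, ‖errorQ (u (k + 1) ω) (hbar g)‖ ^ 4 ∂P := by
    have hs1 : Summable fun k : ℕ => 256 * errorConst (Fin J ⊕ Fin J) * mseFormula g σ 1 ^ 2 *
        (1 / ((k + 1 : ℕ) : ℝ) ^ 2) :=
      ((summable_nat_add_iff 1).2 (Real.summable_one_div_nat_pow.2 one_lt_two)).mul_left _
    refine hs1.of_nonneg_of_le (fun k => integral_nonneg fun ω => by positivity) fun k => ?_
    refine ((hM.integral_errorQ_bounds hg (N := k + 1) (by omega) (hum _)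
      (hu _ (by omega))).1).trans (le_of_eq ?_)
    simp only [mseFormula, Nat.cast_one, one_mul, one_div, mul_inv]
    ring
  filter_upwards [ae_tendsto_zero_of_summable hi hs] with ω hω
  exact (tendsto_add_atTop_iff_nat 1).1 hω

/-- As `μ² ≤ ‖q‖² · ‖q‖²`, almost sure convergence of `q` to zero suffices. -/
theorem IsBPSKModel.ae_isLittleO (hM : IsBPSKModel P σ b n) (hg : g ≠ 0)
    {u : ℕ → Ω → EuclideanSpace ℝ (Fin J ⊕ Fin J)} (hum : ∀ N, AEMeasurable (u N) P)
    (hu : ∀ N, 1 ≤ N → ∀ᵐ ω ∂P, IsTopUnitEigenvector (sampleCovBar g b n N ω) (u N ω)) :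
    ∀ᵐ ω ∂P, (fun N => |errorMu (u N ω) (hbar g)| ^ 2) =o[atTop]
      (fun N => ‖errorQ (u N ω) (hbar g)‖ ^ 2) := by
  have hu' : ∀ᵐ ω ∂P, ∀ N, 1 ≤ N → IsTopUnitEigenvector (sampleCovBar g b n N ω) (u N ω) := by
    rw [ae_all_iff]
    intro N
    by_cases hN : 1 ≤ N
    · filter_upwards [hu N hN] with ω h _ using h
    · exact Eventually.of_forall fun ω h => absurd h hN
  filter_upwards [hM.ae_tendsto_errorQ hg hum hu, hu'] with ω hω huω
  refine isLittleO_iff.2 fun c hc => ?_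
  filter_upwards [hω.eventually (gt_mem_nhds (sq_pos_of_pos hc)), eventually_ge_atTop 1]
    with N hN hN1
  have h1 := abs_errorMu_sq_le (norm_hbar hg) (huω N hN1).1
  rw [Real.norm_of_nonneg (sq_nonneg _), Real.norm_of_nonneg (sq_nonneg _)]
  have h2 : ‖errorQ (u N ω) (hbar g)‖ ^ 2 ≤ c := by
    refine le_of_sq_le_sq ?_ hc.le
    rw [← pow_mul]
    exact hN.le
  calc _ ≤ ‖errorQ (u N ω) (hbar g)‖ ^ 4 := h1
    _ = ‖errorQ (u N ω) (hbar g)‖ ^ 2 * ‖errorQ (u N ω) (hbar g)‖ ^ 2 := by ring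
    _ ≤ _ := mul_le_mul_of_nonneg_right h2 (sq_nonneg _)

end Model

end SIMO

theorem theorem2 (J : ℕ) :
    -- fixed channel and noise level, sample size tending to infinity
    (∀ (Ω : Type*) [MeasurableSpace Ω] (P : Measure Ω) [IsProbabilityMeasure P]
      (g : EuclideanSpace ℂ (Fin J)) (σ : ℝ) (b : ℕ → Ω → ℝ)
      (n : ℕ → Ω → EuclideanSpace ℂ (Fin J)),
      g ≠ 0 → 0 < σ → SIMO.IsBPSKModel P σ b n →
      -- the exact second-order moment of the covariance estimation error
      (∀ N : ℕ, 1 ≤ N →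
        (∀ k l, Integrable (fun ω => (SIMO.deltaCovBar P g b n N ω *
          Matrix.vecMulVec (SIMO.hbar g).ofLp (SIMO.hbar g).ofLp *
          SIMO.deltaCovBar P g b n N ω) k l) P) ∧
        (Matrix.of fun k l => ∫ ω, (SIMO.deltaCovBar P g b n N ω *
          Matrix.vecMulVec (SIMO.hbar g).ofLp (SIMO.hbar g).ofLp *
          SIMO.deltaCovBar P g b n N ω) k l ∂P) =
        (1 / (N : ℝ)) •
          ((3 / 2 * σ ^ 2 * ‖g‖ ^ 2 + σ ^ 4 / 4) •
              Matrix.vecMulVec (SIMO.hbar g).ofLp (SIMO.hbar g).ofLp +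
            (σ ^ 2 / 2 * ‖g‖ ^ 2 + σ ^ 4 / 4) •
              (1 : Matrix (Fin J ⊕ Fin J) (Fin J ⊕ Fin J) ℝ))) ∧
      ∀ u : ℕ → Ω → EuclideanSpace ℝ (Fin J ⊕ Fin J),
        (∀ N, AEMeasurable (u N) P) →
        (∀ N, 1 ≤ N → ∀ᵐ ω ∂P,
          SIMO.IsTopUnitEigenvector (SIMO.sampleCovBar g b n N ω) (u N ω)) →
        -- the component along the channel is negligible, almost surely and in mean square
        (∀ᵐ ω ∂P, (fun N => |SIMO.errorMu (u N ω) (SIMO.hbar g)| ^ 2) =o[atTop]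
          (fun N => ‖SIMO.errorQ (u N ω) (SIMO.hbar g)‖ ^ 2)) ∧
        ((fun N => ∫ ω, |SIMO.errorMu (u N ω) (SIMO.hbar g)| ^ 2 ∂P) =o[atTop]
          (fun N => ∫ ω, ‖SIMO.errorQ (u N ω) (SIMO.hbar g)‖ ^ 2 ∂P)) ∧
        -- the mean-squared error
        IsEquivalent atTop
          (fun N => ∫ ω, ‖SIMO.errorVec (u N ω) (SIMO.hbar g)‖ ^ 2 ∂P)
          (fun N => ∫ ω, ‖SIMO.errorQ (u N ω) (SIMO.hbar g)‖ ^ 2 ∂P) ∧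
        IsEquivalent atTop
          (fun N => ∫ ω, ‖SIMO.errorQ (u N ω) (SIMO.hbar g)‖ ^ 2 ∂P)
          (fun N => SIMO.mseFormula g σ N)) ∧
    -- the same approximations, uniformly in channel, noise level and sample size, whenever the
    -- closed form is small (this covers a fixed sample size at high signal-to-noise ratio)
    (∀ ε : ℝ, 0 < ε → ∃ η : ℝ, 0 < η ∧
      ∀ (Ω : Type*) [MeasurableSpace Ω] (P : Measure Ω) [IsProbabilityMeasure P]
        (g : EuclideanSpace ℂ (Fin J)) (σ : ℝ) (b : ℕ → Ω → ℝ)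
        (n : ℕ → Ω → EuclideanSpace ℂ (Fin J)) (N : ℕ)
        (u : Ω → EuclideanSpace ℝ (Fin J ⊕ Fin J)),
        g ≠ 0 → 0 < σ → SIMO.IsBPSKModel P σ b n → 1 ≤ N → AEMeasurable u P →
        (∀ᵐ ω ∂P, SIMO.IsTopUnitEigenvector (SIMO.sampleCovBar g b n N ω) (u ω)) →
        SIMO.mseFormula g σ N ≤ η →
        P.real {ω | ε * ‖SIMO.errorQ (u ω) (SIMO.hbar g)‖ ^ 2 <
          |SIMO.errorMu (u ω) (SIMO.hbar g)| ^ 2} ≤ ε ∧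
        ∫ ω, |SIMO.errorMu (u ω) (SIMO.hbar g)| ^ 2 ∂P ≤
          ε * ∫ ω, ‖SIMO.errorQ (u ω) (SIMO.hbar g)‖ ^ 2 ∂P ∧
        |∫ ω, ‖SIMO.errorVec (u ω) (SIMO.hbar g)‖ ^ 2 ∂P -
            ∫ ω, ‖SIMO.errorQ (u ω) (SIMO.hbar g)‖ ^ 2 ∂P| ≤
          ε * ∫ ω, ‖SIMO.errorQ (u ω) (SIMO.hbar g)‖ ^ 2 ∂P ∧
        |∫ ω, ‖SIMO.errorQ (u ω) (SIMO.hbar g)‖ ^ 2 ∂P - SIMO.mseFormula g σ N| ≤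
          ε * SIMO.mseFormula g σ N) := by
  refine ⟨?_, fun ε hε => SIMO.exists_uniform_bound J ε hε⟩
  intro Ω _ P _ g σ b n hg hσ hM
  refine ⟨fun N hN => hM.integral_deltaCovBar hg hN, fun u hum hu => ?_⟩
  -- For a fixed channel the closed form eventually drops below `η`, so the mean-square asymptotics
  -- are instances of the uniform bound. Its probability estimate is dropped, being too weak for the
  -- almost sure claim.
  have hev (ε : ℝ) (hε : 0 < ε) : ∀ᶠ N in atTop,
      ∫ ω, |SIMO.errorMu (u N ω) (SIMO.hbar g)| ^ 2 ∂P ≤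
        ε * ∫ ω, ‖SIMO.errorQ (u N ω) (SIMO.hbar g)‖ ^ 2 ∂P ∧
      |∫ ω, ‖SIMO.errorVec (u N ω) (SIMO.hbar g)‖ ^ 2 ∂P -
          ∫ ω, ‖SIMO.errorQ (u N ω) (SIMO.hbar g)‖ ^ 2 ∂P| ≤
        ε * ∫ ω, ‖SIMO.errorQ (u N ω) (SIMO.hbar g)‖ ^ 2 ∂P ∧
      |∫ ω, ‖SIMO.errorQ (u N ω) (SIMO.hbar g)‖ ^ 2 ∂P - SIMO.mseFormula g σ N| ≤
        ε * SIMO.mseFormula g σ N := by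
    obtain ⟨η, hη, h⟩ := SIMO.exists_uniform_bound J ε hε
    have h1 := (SIMO.tendsto_mseFormula g σ).eventually (gt_mem_nhds hη)
    exact (h1.and (eventually_ge_atTop 1)).mono fun N hN =>
      (h Ω P g σ b n N (u N) hg hσ hM hN.2 (hum N) (hu N hN.2) hN.1.le).2
  have hnonneg (f : Ω → ℝ) (hf : ∀ ω, 0 ≤ f ω) : ‖∫ ω, f ω ∂P‖ = ∫ ω, f ω ∂P := by
    rw [Real.norm_eq_abs, abs_of_nonneg (integral_nonneg hf)]
  refine ⟨hM.ae_isLittleO hg hum hu, isLittleO_iff.2 fun c hc => ?_,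
    isLittleO_iff.2 fun c hc => ?_, isLittleO_iff.2 fun c hc => ?_⟩
  · filter_upwards [hev c hc] with N hN
    rw [hnonneg _ fun ω => sq_nonneg _, hnonneg _ fun ω => sq_nonneg _]
    exact hN.1
  · filter_upwards [hev c hc] with N hN
    rw [hnonneg _ fun ω => sq_nonneg _, Pi.sub_apply, Real.norm_eq_abs]
    exact hN.2.1
  · filter_upwards [hev c hc, eventually_ge_atTop 1] with N hN hN1
    rw [Pi.sub_apply, Real.norm_eq_abs, Real.norm_eq_abs,
      abs_of_pos (SIMO.IsBPSKModel.mseFormula_pos hg hσ hN1)]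
    exact hN.2.2
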